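/- Let $\mathbb K=\mathbb R$ or $\mathbb C$, let $B,\bar B$ be Banach spaces over $\mathbb K$, let $U\subset\mathbb K$ be an open neighbourhood of $0$, and let $L:U\to L[B,\bar B]$ be analytic with values in the bounded operators, with expansion $L(\varepsilon)=\sum_{i\ge 0}\varepsilon^iL_i$ near $0$, $L_i\in L[B,\bar B]$. **Stabilization.** For $b_0\in B$ let $\operatorname{rank}(b_0)=0$ if $L_0b_0\neq 0$, and otherwise let $\operatorname{rank}(b_0)$ be the supremum of all $m\ge1$ for which there are $b_1,\dots,b_{m-1}\in B$ with $\sum_{i=0}^{j}L_ib_{j-i}=0$ for $j=0,\dots,m-1$. Assume that $L$ stabilizes at level $k\ge 0$: $\operatorname{rank}(b_0)\in\{0,\dots,k\}\cup\{\infty\}$ for all $b_0\in B$, and $\operatorname{rank}(b_0)=k$ for some $b_0$. **Recursion.** Put $N_0=B$, $N_0^c=\{0\}$, $R_0=\{0\}$, $R_0^c=\bar B$. For $n=1,2,\dots$ let $$\bar S_1=L_0,\qquad \bar S_n=\sum_{i=1}^{n-1}L_iM_{i,n-1}\ (n\ge2),\qquad S_n=(I-\mathcal P_1-\dots-\mathcal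 P_{n-1})\bar S_n,$$ $$N_n=\{b\in N_{n-1}: S_nb=0\},\qquad R_n=S_n(N_{n-1}),$$ and choose arbitrary algebraic complements $N_{n-1}=N_n^c\oplus N_n$, $R_{n-1}^c=R_n\oplus R_n^c$. Let $\mathcal P_n$ be the projection of $\bar B=R_1\oplus\dots\oplus R_n\oplus R_n^c$ to $R_n$, let $S_n^{-1}:R_n\to N_n^c$ be the inverse of the bijection $S_n:N_n^c\to R_n$, and put $E_{n,n}=I$, $E_{i,n}=-S_i^{-1}\mathcal P_i\sum_{v=i+1}^{n}\bar S_vE_{v,n}$ for $i=n-1,\dots,1$, and $M_{1,n}=E_{1,n}$, $M_{i,n}=\sum_{j=i}^{n}M_{i-1,j-1}E_{j,n}$ for $2\le i\le n$. For $1\le i\le k+1$ let $P_i$ be the projection of $B=N_1^c\oplus\dots\oplus N_{k+1}^c\oplus N_{k+1}$ to $N_i^c$. Assume that $P_i$ and $\mathcal P_i$ are continuous for $i=1,\dots,k+1$. Put $$\phi_i=M_{k+1,k+1+i}\ (i\ge0),\qquad \psi_0=I,\quad \psi_i=\sum_{j=1}^{k+1}S_{i+j}S_j^{-1}\mathcal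 P_j\ (i\ge1).$$ **Theorem.** The operators $S_i$ $(i\ge 1)$, $S_i^{-1}\mathcal P_i$ $(1\le i\le k+1)$, $\phi_i$ and $\psi_i$ $(i\ge 0)$ are bounded, and there is an open neighbourhood $V\subset U$ of $0$ such that the following holds. (i) The series $\phi(\varepsilon)=\sum\varepsilon^i\phi_i$ and $\psi(\varepsilon)=\sum\varepsilon^i\psi_i$ converge in operator norm and are analytic on $V$, $\phi(0)=I$, $\psi(0)=I$, and $\phi(\varepsilon)$, $\psi(\varepsilon)$ are bijective for $\varepsilon\in V$ with bounded inverses $\phi^{-1}(\varepsilon)$, $\psi^{-1}(\varepsilon)$ that are analytic in $\varepsilon$. The family $L(\varepsilon)\phi(\varepsilon)$ is analytic on $V$ and equals $\sum_{i\ge0}\varepsilon^iS_{i+1}$ there. For $1\le i\le k+1$: $S_i(N_0^c+\dots+N_{i-1}^c)\subset R_{i-1}^c$, $S_i(N_i^c)=R_i$ and $S_i(N_i)=0$. For $l\ge2$: $S_{k+l}(B)\subset R_{k+1}^c$ and $S_{k+l}(N_{k+1})=0$. In particular $S_i(N_{k+1})=0$ for all $i\ge1$. (ii) For $\varepsilon\in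 V$: $\psi^{-1}(\varepsilon)L(\varepsilon)\phi(\varepsilon)=\Delta(\varepsilon):=S_1P_1+\varepsilon S_2P_2+\dots+\varepsilon^kS_{k+1}P_{k+1}$. (iii) For $\varepsilon\in V\setminus\{0\}$, the kernel and the range of $L(\varepsilon)$ are $N[L(\varepsilon)]=\phi(\varepsilon)N_{k+1}$ and $R[L(\varepsilon)]=\psi(\varepsilon)[R_1\oplus\dots\oplus R_{k+1}]$. (iv) For $\varepsilon\ne0$ the operator $\Delta^{-1}(\varepsilon):=S_1^{-1}\mathcal P_1+\dots+\varepsilon^{-k}S_{k+1}^{-1}\mathcal P_{k+1}$ is a generalized inverse of $\Delta(\varepsilon)$ (where $G$ is a generalized inverse of $A$ if $AGA=A$ and $GAG=G$); it is analytic for $\varepsilon\neq 0$ with a pole of order exactly $k$ at $\varepsilon=0$. For $\varepsilon\in V\setminus\{0\}$ the operator $L^{-1}(\varepsilon):=\phi(\varepsilon)\Delta^{-1}(\varepsilon)\psi^{-1}(\varepsilon)$ is a generalized inverse of $L(\varepsilon)$; it is analytic on $V\setminus\{0\}$ with a pole of order exactly $k$ at $0$ (for $k=0$: it extends analytically to $0$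 with a value different from $0$). For $\varepsilon\in V\setminus\{0\}$ $$L^{-1}(\varepsilon)L(\varepsilon)=\phi(\varepsilon)(P_1+\dots+P_{k+1})\phi^{-1}(\varepsilon),\qquad L(\varepsilon)L^{-1}(\varepsilon)=\psi(\varepsilon)(\mathcal P_1+\dots+\mathcal P_{k+1})\psi^{-1}(\varepsilon).$$ For every $\varepsilon\in V$ the right-hand sides are projections with ranges $\phi(\varepsilon)[N_1^c\oplus\dots\oplus N_{k+1}^c]$ and $\psi(\varepsilon)[R_1\oplus\dots\oplus R_{k+1}]$; they are analytic on all of $V$ and at $\varepsilon=0$ equal $P_1+\dots+P_{k+1}$ and $\mathcal P_1+\dots+\mathcal P_{k+1}$. -/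

import Mathlib

noncomputable section

namespace OperatorDiag

/-! ### Jordan chains and stabilization of a formal operator power series -/

section Jordan

variable {𝕜 X Y : Type*} [Field 𝕜] [AddCommGroup X] [Module 𝕜 X] [AddCommGroup Y] [Module 𝕜 Y]

/-- `b 0, …, b (m-1)` is annihilated by the triangular Toeplitz matrix of `L 0, …, L (m-1)`:
`L₀ bⱼ + L₁ bⱼ₋₁ + ⋯ + Lⱼ b₀ = 0` for `j = 0, …, m-1`. -/
def IsChain (L : ℕ → X →ₗ[𝕜] Y) (m : ℕ) (b : ℕ → X) : Prop :=
  ∀ j < m, ∑ i ∈ Finset.range (j + 1), L i (b (j - i)) = 0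

open Classical in
/-- The rank of `b₀`: zero off the kernel of `L 0`, and otherwise the supremum of the lengths
of the chains that start at `b₀`. -/
def rank (L : ℕ → X →ₗ[𝕜] Y) (b₀ : X) : ℕ∞ :=
  if L 0 b₀ ≠ 0 then 0
  else ⨆ m ∈ {m : ℕ | 1 ≤ m ∧ ∃ b : ℕ → X, b 0 = b₀ ∧ IsChain L m b}, (m : ℕ∞)

/-- Every rank is in `{0, …, k} ∪ {∞}` and the rank `k` occurs. -/
def StabilizesAt (L : ℕ → X →ₗ[𝕜] Y) (k : ℕ) : Prop :=
  (∀ b₀, rank L b₀ ≤ k ∨ rank L b₀ = ⊤) ∧ ∃ b₀, rank L b₀ = k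

end Jordan

/-! ### The recursion -/

section Recursion

variable {𝕜 X Y : Type*} [Field 𝕜] [AddCommGroup X] [Module 𝕜 X] [AddCommGroup Y] [Module 𝕜 Y]

open Classical in
/-- The projection to `p` along `q`, for complementary subspaces `p` and `q`. -/
def projOnto (p q : Submodule 𝕜 X) : X →ₗ[𝕜] p :=
  if h : IsCompl p q then p.projectionOnto q h else 0

open Classical in
/-- The inverse `q → p` of the restriction `p → q` of `f`, for bijective restrictions. -/
def invOn (f : X →ₗ[𝕜] Y) (p : Submodule 𝕜 X) (q : Submodule 𝕜 Y) : q →ₗ[𝕜] X :=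
  if h : ∃ hm : ∀ x ∈ p, f x ∈ q, Function.Bijective (f.restrict hm) then
    p.subtype ∘ₗ (LinearEquiv.ofBijective _ h.choose_spec).symm.toLinearMap
  else 0

/-- The column `E_{·,n}`, from bottom to top: `E_{n,n} = I` and
`E_{i,n} = - Sᵢ⁻¹ 𝒫ᵢ ∑_{v=i+1}^{n} S̄_v E_{v,n}` for `i < n` (and `0` for `i > n`);
here `T i` stands for `Sᵢ⁻¹ 𝒫ᵢ`. -/
def colE (Sbar : ℕ → X →ₗ[𝕜] Y) (T : ℕ → Y →ₗ[𝕜] X) (n i : ℕ) : X →ₗ[𝕜] X :=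
  if i = n then LinearMap.id
  else if i < n then
    -(T i ∘ₗ ∑ v ∈ (Finset.Icc (i + 1) n).attach, Sbar v.1 ∘ₗ colE Sbar T n v.1)
  else 0
termination_by n - i
decreasing_by
  have := Finset.mem_Icc.1 v.2
  omega

/-- The objects made at one stage `n` of the recursion: `S̄ₙ`, `Sₙ`, `Nₙ`, `Rₙ`, the projection
`𝒫ₙ`, the operator `Tₙ = Sₙ⁻¹ 𝒫ₙ`, and the columns `E_{·,n}` and `M_{·,n}`. -/
structure Stage (𝕜 X Y : Type*) [Field 𝕜] [AddCommGroup X] [Module 𝕜 X]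
    [AddCommGroup Y] [Module 𝕜 Y] where
  Sbar : X →ₗ[𝕜] Y
  S : X →ₗ[𝕜] Y
  N : Submodule 𝕜 X
  R : Submodule 𝕜 Y
  Q : Y →ₗ[𝕜] Y
  T : Y →ₗ[𝕜] X
  E : ℕ → X →ₗ[𝕜] X
  M : ℕ → X →ₗ[𝕜] X

/-- Stage `0` is trivial: `N₀ = X`, `R₀ = 0`. -/
def stageZero : Stage 𝕜 X Y where
  Sbar := 0
  S := 0
  N := ⊤
  R := ⊥
  Q := 0
  T := 0
  E := 0
  M := 0

/-- Stage `k + 1`, from the stages `h 0, …, h k` and the complements `Nᶜ`, `Rᶜ`. -/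
def step (L : ℕ → X →ₗ[𝕜] Y) (Nc : ℕ → Submodule 𝕜 X) (Rc : ℕ → Submodule 𝕜 Y)
    (k : ℕ) (h : ℕ → Stage 𝕜 X Y) : Stage 𝕜 X Y :=
  let Sbar : X →ₗ[𝕜] Y :=
    if k = 0 then L 0 else ∑ i ∈ Finset.Icc 1 k, L i ∘ₗ (h k).M i
  let S : X →ₗ[𝕜] Y := (LinearMap.id - ∑ i ∈ Finset.Icc 1 k, (h i).Q) ∘ₗ Sbar
  let R : Submodule 𝕜 Y := (h k).N.map S
  let π : Y →ₗ[𝕜] R := projOnto R ((⨆ i ∈ Finset.Icc 1 k, (h i).R) ⊔ Rc (k + 1))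
  let E : ℕ → X →ₗ[𝕜] X :=
    colE (fun v => if v = k + 1 then Sbar else (h v).Sbar) (fun i => (h i).T) (k + 1)
  { Sbar := Sbar
    S := S
    N := (h k).N ⊓ LinearMap.ker S
    R := R
    Q := R.subtype ∘ₗ π
    T := invOn S (Nc (k + 1)) R ∘ₗ π
    E := E
    M := fun i =>
      if i = 1 then E 1 else ∑ j ∈ Finset.Icc i (k + 1), (h (j - 1)).M (i - 1) ∘ₗ E j }

/-- `history n` holds the stages `0, …, n`. -/
def history (L : ℕ → X →ₗ[𝕜] Y) (Nc : ℕ → Submodule 𝕜 X) (Rc : ℕ → Submodule 𝕜 Y) :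
    ℕ → ℕ → Stage 𝕜 X Y
  | 0 => fun _ => stageZero
  | n + 1 => Function.update (history L Nc Rc n) (n + 1) (step L Nc Rc n (history L Nc Rc n))

/-- Stage `n` of the recursion. -/
def stage (L : ℕ → X →ₗ[𝕜] Y) (Nc : ℕ → Submodule 𝕜 X) (Rc : ℕ → Submodule 𝕜 Y) (n : ℕ) :
    Stage 𝕜 X Y :=
  history L Nc Rc n n

/-- The recursion for the series `∑ εⁱ Lᵢ`. The only freedom is the choice, at each stage, of
algebraic complements `Nᶜₙ₊₁` of `Nₙ₊₁` in `Nₙ` and `Rᶜₙ₊₁` of `Rₙ₊₁` in `Rᶜₙ`; every other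
object is computed from them. -/
structure Recursion (L : ℕ → X →ₗ[𝕜] Y) where
  Nc : ℕ → Submodule 𝕜 X
  Rc : ℕ → Submodule 𝕜 Y
  Nc_zero : Nc 0 = ⊥
  Rc_zero : Rc 0 = ⊤
  disjoint_N : ∀ n, Disjoint (Nc (n + 1)) (stage L Nc Rc (n + 1)).N
  sup_N : ∀ n, Nc (n + 1) ⊔ (stage L Nc Rc (n + 1)).N = (stage L Nc Rc n).N
  disjoint_R : ∀ n, Disjoint (stage L Nc Rc (n + 1)).R (Rc (n + 1))
  sup_R : ∀ n, (stage L Nc Rc (n + 1)).R ⊔ Rc (n + 1) = Rc n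

namespace Recursion

variable {L : ℕ → X →ₗ[𝕜] Y} (D : Recursion L)

/-- `Sₙ` -/
def S (n : ℕ) : X →ₗ[𝕜] Y := (stage L D.Nc D.Rc n).S

/-- `Nₙ` -/
def N (n : ℕ) : Submodule 𝕜 X := (stage L D.Nc D.Rc n).N

/-- `Rₙ` -/
def R (n : ℕ) : Submodule 𝕜 Y := (stage L D.Nc D.Rc n).R

/-- The projection `𝒫ₙ` of `Y = R₁ ⊕ ⋯ ⊕ Rₙ ⊕ Rᶜₙ` to `Rₙ`. -/
def Q (n : ℕ) : Y →ₗ[𝕜] Y := (stage L D.Nc D.Rc n).Q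

/-- `Tₙ = Sₙ⁻¹ 𝒫ₙ`, where `Sₙ⁻¹ : Rₙ → Nᶜₙ` -/
def T (n : ℕ) : Y →ₗ[𝕜] X := (stage L D.Nc D.Rc n).T

/-- `M_{i,n}` -/
def M (i n : ℕ) : X →ₗ[𝕜] X := (stage L D.Nc D.Rc n).M i

/-- The projection `Pₙ` of `X = Nᶜ₁ ⊕ ⋯ ⊕ Nᶜₙ ⊕ Nₙ` to `Nᶜₙ`; since
`Nₙ = Nᶜₙ₊₁ ⊕ ⋯ ⊕ Nᶜₖ₊₁ ⊕ Nₖ₊₁`, the finer decompositions give the same projection. -/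
def P (n : ℕ) : X →ₗ[𝕜] X :=
  (D.Nc n).subtype ∘ₗ projOnto (D.Nc n) ((⨆ j ∈ Finset.Ico 1 n, D.Nc j) ⊔ D.N n)

/-- The coefficient `φᵢ = M_{k+1,k+1+i}`. -/
def phi (k i : ℕ) : X →ₗ[𝕜] X := D.M (k + 1) (k + 1 + i)

/-- The coefficient `ψᵢ`: `ψ₀ = I` and
`ψᵢ = Sᵢ₊₁ S₁⁻¹ 𝒫₁ + ⋯ + Sᵢ₊ₖ₊₁ Sₖ₊₁⁻¹ 𝒫ₖ₊₁` for `i ≥ 1`. -/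
def psi (k i : ℕ) : Y →ₗ[𝕜] Y :=
  if i = 0 then LinearMap.id else ∑ j ∈ Finset.Icc 1 (k + 1), D.S (i + j) ∘ₗ D.T j

end Recursion

end Recursion

/-! ### Bounded operators -/

section Bounded

variable {𝕜 X Y : Type*} [RCLike 𝕜] [NormedAddCommGroup X] [NormedSpace 𝕜 X]
  [NormedAddCommGroup Y] [NormedSpace 𝕜 Y]

/-- `Δ(ε) = S₁ P₁ + ε S₂ P₂ + ⋯ + εᵏ Sₖ₊₁ Pₖ₊₁` -/
def Delta (k : ℕ) (S : ℕ → X →L[𝕜] Y) (P : ℕ → X →L[𝕜] X) (ε : 𝕜) : X →L[𝕜] Y :=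
  ∑ i ∈ Finset.range (k + 1), ε ^ i • (S (i + 1) ∘L P (i + 1))

/-- `Δ⁻¹(ε) = T₁ + ε⁻¹ T₂ + ⋯ + ε⁻ᵏ Tₖ₊₁` with `Tᵢ = Sᵢ⁻¹ 𝒫ᵢ` (used for `ε ≠ 0`) -/
def DeltaInv (k : ℕ) (T : ℕ → Y →L[𝕜] X) (ε : 𝕜) : Y →L[𝕜] X :=
  ∑ i ∈ Finset.range (k + 1), (ε ^ i)⁻¹ • T (i + 1)

/-- `G` is a generalized inverse of `A`. -/
def IsGenInverse (A : X →L[𝕜] Y) (G : Y →L[𝕜] X) : Prop :=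
  A ∘L G ∘L A = A ∧ G ∘L A ∘L G = G

/-- `f` has a pole of order (exactly) `k` at `0`; order `0` means that `f` extends analytically
to `0` by a value different from zero. -/
def HasPole {E : Type*} [NormedAddCommGroup E] [NormedSpace 𝕜 E] (f : 𝕜 → E) (k : ℕ) : Prop :=
  MeromorphicAt f 0 ∧ meromorphicOrderAt f 0 = ((-(k : ℤ) : ℤ) : WithTop ℤ)

end Bounded

end OperatorDiag

end

/-! Everything rests on the identity `sum_L_M`: `∑_{i=1}^{n} L_{i-1} M_{i+m,n+m} = Sₙ` for every
shift `m`. For `m = 0`, the column `E_{·,n}` is a back substitution that cancels the components of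
`∑ S̄_v E_{v,n}` in `R₁, …, Rₙ₋₁` and leaves `Sₙ` (`sum_Sbar_E`). Raising `m` only adds terms in
which some `S_l` acts on a space `Nᶜⱼ` with `l < j`, and these vanish.

So the polynomial with coefficients `M_{m-i,m} x` starts at `x`, and `L(ε)` sends it to a series
whose coefficients below order `m` are `S₁x, S₂x, …`. Comparing any chain with it shows that `Nₙ`
consists of the starting vectors of chains of length `n` (`mem_of_chain`), so the rank is at least
`n` exactly on `Nₙ` (`le_rank_iff`). Stabilization at level `k` therefore means `Nₙ = Nₖ₊₁` for `n ≥
k + 1`, with `Nᶜₖ₊₁ ≠ 0`. From stage `k + 2` on, `Nᶜₙ`, `𝒫ₙ` and `Sₙ⁻¹𝒫ₙ` are zero, and `M_{i,n}`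
with `i ≥ k + 1` depends on `n - i` only. This turns `sum_L_M` into `L(ε)φ(ε) = ∑ εⁱ Sᵢ₊₁`. Since
`Sₙ₊₁` kills what the projections `P` leave over, the same series is `ψ(ε)Δ(ε)` (`sum_psi_S_P`).

For convergence, the closed graph theorem bounds `Sᵢ⁻¹𝒫ᵢ` (`continuous_T`). Past stage `k + 1` the
recursion is linear with fixed bounded operators, `M_{i+1,n+1} = M_{i,n} + Hᵢ S̄ₙ₊₁` and `S̄ₙ₊₁ = ∑
Lᵢ M_{i,n}`, which forces geometric growth (`geomBdd_phi`). Near `0` both `φ` and `ψ` are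
invertible, so `L = ψ Δ φ⁻¹`. Kernels, ranges, generalized inverses and projections are those of
`Δ`, carried over by `φ` and `ψ`. The pole has order exactly `k` because `Sₖ₊₁⁻¹𝒫ₖ₊₁ ≠ 0`. -/

noncomputable section

namespace OperatorDiag

/-! ### Projections of an iterated direct sum decomposition -/

section Splitting

variable {𝕜 X : Type*} [Field 𝕜] [AddCommGroup X] [Module 𝕜 X]

/-- `X = A 1 ⊕ ⋯ ⊕ A n ⊕ Z n` for all `n`, by successive splittings `Z n = A (n+1) ⊕ Z (n+1)`. -/
structure IsSplitting (A Z : ℕ → Submodule 𝕜 X) : Prop where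
  zero : Z 0 = ⊤
  disjoint : ∀ n, Disjoint (A (n + 1)) (Z (n + 1))
  sup : ∀ n, A (n + 1) ⊔ Z (n + 1) = Z n

/-- The projection to `A n` along `A 1 ⊕ ⋯ ⊕ A (n-1) ⊕ Z n`. -/
def splitProj (A Z : ℕ → Submodule 𝕜 X) (n : ℕ) : X →ₗ[𝕜] X :=
  (A n).subtype ∘ₗ projOnto (A n) ((⨆ j ∈ Finset.Ico 1 n, A j) ⊔ Z n)

theorem splitProj_mem (A Z : ℕ → Submodule 𝕜 X) (n : ℕ) (x : X) : splitProj A Z n x ∈ A n := by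
  simp [splitProj]

theorem sum_splitProj_mem (A Z : ℕ → Submodule 𝕜 X) (n : ℕ) (x : X) :
    ∑ i ∈ Finset.Icc 1 n, splitProj A Z i x ∈ ⨆ i ∈ Finset.Icc 1 n, A i :=
  Submodule.sum_mem _ fun i hi =>
    Submodule.mem_iSup_of_mem i (Submodule.mem_iSup_of_mem hi (splitProj_mem A Z i x))

namespace IsSplitting

variable {A Z : ℕ → Submodule 𝕜 X} (h : IsSplitting A Z)
include h

theorem antitone : Antitone Z := antitone_nat_of_succ_le fun n => by
  rw [← h.sup n]; exact le_sup_right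

theorem le_of_lt {m n : ℕ} (hmn : m < n) : A n ≤ Z m := by
  obtain ⟨n, rfl⟩ : ∃ l, n = l + 1 := ⟨n - 1, by omega⟩
  refine le_trans ?_ (h.antitone (Nat.lt_succ_iff.1 hmn))
  rw [← h.sup n]; exact le_sup_left

theorem isCompl_iSup (n : ℕ) : IsCompl (⨆ j ∈ Finset.Ico 1 (n + 1), A j) (Z n) := by
  induction n with
  | zero => simpa [h.zero] using isCompl_bot_top
  | succ n ih =>
    have e : (⨆ j ∈ Finset.Ico 1 (n + 1 + 1), A j) = (⨆ j ∈ Finset.Ico 1 (n + 1), A j) ⊔ A (n + 1) := by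
      rw [← Finset.insert_Ico_right_eq_Ico_add_one (by omega : 1 ≤ n + 1), Finset.iSup_insert,
        sup_comm]
    rw [e]
    rw [← h.sup n] at ih
    exact ⟨(h.disjoint n).disjoint_sup_left_of_disjoint_sup_right ih.disjoint,
      codisjoint_assoc.mpr ih.codisjoint⟩

theorem isCompl (n : ℕ) :
    IsCompl (A (n + 1)) ((⨆ j ∈ Finset.Ico 1 (n + 1), A j) ⊔ Z (n + 1)) := by
  have ih := (h.isCompl_iSup n).symm
  rw [← h.sup n] at ih
  refine ⟨?_, ?_⟩
  · rw [sup_comm]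
    exact (h.disjoint n).disjoint_sup_right_of_disjoint_sup_left ih.disjoint
  · rw [sup_comm (⨆ j ∈ Finset.Ico 1 (n + 1), A j)]
    exact codisjoint_assoc.mp ih.codisjoint

theorem splitProj_of_mem {n : ℕ} (hn : 1 ≤ n) {x : X} (hx : x ∈ A n) : splitProj A Z n x = x := by
  obtain ⟨n, rfl⟩ : ∃ l, n = l + 1 := ⟨n - 1, by omega⟩
  simp only [splitProj, projOnto, dif_pos (h.isCompl n), LinearMap.comp_apply]
  exact congrArg Subtype.val (Submodule.projectionOnto_apply_left (h.isCompl n) ⟨x, hx⟩)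

theorem splitProj_eq_zero {n : ℕ} (hn : 1 ≤ n) {x : X}
    (hx : x ∈ (⨆ j ∈ Finset.Ico 1 n, A j) ⊔ Z n) : splitProj A Z n x = 0 := by
  obtain ⟨n, rfl⟩ : ∃ l, n = l + 1 := ⟨n - 1, by omega⟩
  simp only [splitProj, projOnto, dif_pos (h.isCompl n), LinearMap.comp_apply]
  rw [(Submodule.projectionOnto_apply_eq_zero_iff (h.isCompl n)).2 hx, map_zero]

theorem splitProj_of_mem_rem {m n : ℕ} (hn : 1 ≤ n) (hnm : n ≤ m) {x : X} (hx : x ∈ Z m) :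
    splitProj A Z n x = 0 :=
  h.splitProj_eq_zero hn (Submodule.mem_sup_right (h.antitone hnm hx))

theorem splitProj_of_mem_ne {i n : ℕ} (hi : 1 ≤ i) (hn : 1 ≤ n) (hin : i ≠ n) {x : X}
    (hx : x ∈ A i) : splitProj A Z n x = 0 := by
  rcases lt_or_gt_of_ne hin with hlt | hlt
  · refine h.splitProj_eq_zero hn (Submodule.mem_sup_left ?_)
    exact Submodule.mem_iSup_of_mem i (Submodule.mem_iSup_of_mem (by simp; omega) hx)
  · exact h.splitProj_of_mem_rem hn le_rfl (h.le_of_lt hlt hx)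

theorem splitProj_splitProj {i n : ℕ} (hi : 1 ≤ i) (hn : 1 ≤ n) (x : X) :
    splitProj A Z n (splitProj A Z i x) = if i = n then splitProj A Z n x else 0 := by
  split_ifs with e
  · subst e; exact h.splitProj_of_mem hn (splitProj_mem A Z _ _)
  · exact h.splitProj_of_mem_ne hi hn e (splitProj_mem A Z _ _)

/-- The remainder after `n` projections lies in `Z n = A (n+1) ⊕ Z (n+1)`, and the next projection
takes the same value on it as on `x`; subtracting that value leaves the part in `Z (n+1)`. -/
theorem sub_sum_mem (n : ℕ) (x : X) : x - ∑ i ∈ Finset.Icc 1 n, splitProj A Z i x ∈ Z n := by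
  induction n with
  | zero => simp [h.zero]
  | succ n ih =>
    rw [Finset.sum_Icc_succ_top (by omega)]
    set z := x - ∑ i ∈ Finset.Icc 1 n, splitProj A Z i x with hz
    have hP : splitProj A Z (n + 1) z = splitProj A Z (n + 1) x := by
      rw [hz, map_sub, map_sum, Finset.sum_eq_zero, sub_zero]
      intro i hi
      rw [Finset.mem_Icc] at hi
      rw [h.splitProj_splitProj hi.1 (by omega), if_neg (by omega)]
    rw [← hP, ← sub_sub, ← hz]
    rw [← h.sup n] at ih
    obtain ⟨r, hr, c, hc, e⟩ := Submodule.mem_sup.1 ih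
    rw [← e, map_add, h.splitProj_of_mem (by omega) hr,
      h.splitProj_of_mem_rem (by omega) le_rfl hc]
    simpa using hc

theorem mem_of_splitProj_eq_zero {n : ℕ} {x : X}
    (hx : ∀ i ∈ Finset.Icc 1 n, splitProj A Z i x = 0) : x ∈ Z n := by
  simpa [Finset.sum_eq_zero hx] using h.sub_sum_mem n x

theorem sum_splitProj_of_mem {n : ℕ} {x : X} (hx : x ∈ ⨆ i ∈ Finset.Icc 1 n, A i) :
    ∑ i ∈ Finset.Icc 1 n, splitProj A Z i x = x := by
  have : (⨆ i ∈ Finset.Icc 1 n, A i) ≤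
      LinearMap.ker ((∑ i ∈ Finset.Icc 1 n, splitProj A Z i) - LinearMap.id) := by
    refine iSup₂_le fun i hi y hy => ?_
    have hi' := Finset.mem_Icc.1 hi
    rw [LinearMap.mem_ker, LinearMap.sub_apply, LinearMap.sum_apply,
      Finset.sum_eq_single_of_mem i hi, h.splitProj_of_mem hi'.1 hy]
    · simp
    · intro j hj hji
      exact h.splitProj_of_mem_ne hi'.1 (Finset.mem_Icc.1 hj).1 hji.symm hy
  simpa [sub_eq_zero] using this hx

theorem eq_zero_of_mem {n : ℕ} {x : X} (hx : x ∈ ⨆ i ∈ Finset.Icc 1 n, A i) (hz : x ∈ Z n) :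
    x = 0 := by
  rw [← h.sum_splitProj_of_mem hx]
  exact Finset.sum_eq_zero fun i hi =>
    h.splitProj_of_mem_rem (Finset.mem_Icc.1 hi).1 (Finset.mem_Icc.1 hi).2 hz

end IsSplitting

end Splitting

/-! ### The equations of the recursion -/

section Recursion

variable {𝕜 X Y : Type*} [Field 𝕜] [AddCommGroup X] [Module 𝕜 X] [AddCommGroup Y] [Module 𝕜 Y]

/-- An update touches the newest index only, so a stage is never overwritten once it is made. -/
theorem history_eq_stage (L : ℕ → X →ₗ[𝕜] Y) (Nc : ℕ → Submodule 𝕜 X) (Rc : ℕ → Submodule 𝕜 Y)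
    {i n : ℕ} (hin : i ≤ n) : history L Nc Rc n i = stage L Nc Rc i := by
  induction n with
  | zero => obtain rfl : i = 0 := by omega
            rfl
  | succ n ih =>
    rcases Nat.lt_or_ge i (n + 1) with hlt | hge
    · rw [history, Function.update_of_ne (by omega), ih (by omega)]
    · obtain rfl : i = n + 1 := by omega
      rfl

theorem stage_succ (L : ℕ → X →ₗ[𝕜] Y) (Nc : ℕ → Submodule 𝕜 X) (Rc : ℕ → Submodule 𝕜 Y)
    (n : ℕ) : stage L Nc Rc (n + 1) = step L Nc Rc n (history L Nc Rc n) := by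
  simp [stage, history]

/-- Bijectivity is not needed: the default value `0` also lies in `p`. -/
theorem mapsTo_invOn {f : X →ₗ[𝕜] Y} {p : Submodule 𝕜 X} {q : Submodule 𝕜 Y} (y : q) :
    invOn f p q y ∈ p := by
  unfold invOn
  split_ifs <;> simp

theorem apply_invOn {f : X →ₗ[𝕜] Y} {p : Submodule 𝕜 X} {q : Submodule 𝕜 Y}
    (hm : ∀ x ∈ p, f x ∈ q) (hb : Function.Bijective (f.restrict hm)) (y : q) :
    f (invOn f p q y) = y := by
  rw [invOn, dif_pos ⟨hm, hb⟩]
  exact congrArg Subtype.val ((LinearEquiv.ofBijective (f.restrict hm) hb).apply_symm_apply y)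

namespace Recursion

variable {L : ℕ → X →ₗ[𝕜] Y} (D : Recursion L)

/-- `S̄ₙ` -/
def Sbar (n : ℕ) : X →ₗ[𝕜] Y := (stage L D.Nc D.Rc n).Sbar

/-- `E_{i,n}` -/
def E (i n : ℕ) : X →ₗ[𝕜] X := (stage L D.Nc D.Rc n).E i

theorem Sbar_one : D.Sbar 1 = L 0 := by
  simp [Sbar, stage_succ, step]

theorem Sbar_succ {n : ℕ} (hn : 1 ≤ n) :
    D.Sbar (n + 1) = ∑ i ∈ Finset.Icc 1 n, L i ∘ₗ D.M i n := by
  rw [Sbar, stage_succ]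
  simp only [step]
  rw [if_neg (by omega)]
  rfl

theorem S_succ (n : ℕ) :
    D.S (n + 1) = (LinearMap.id - ∑ i ∈ Finset.Icc 1 n, D.Q i) ∘ₗ D.Sbar (n + 1) := by
  rw [S, Sbar, stage_succ]
  simp only [step]
  congr 2
  refine Finset.sum_congr rfl fun i hi => ?_
  rw [history_eq_stage _ _ _ (Finset.mem_Icc.1 hi).2, Q]

theorem N_zero : D.N 0 = ⊤ := rfl

theorem N_succ (n : ℕ) : D.N (n + 1) = D.N n ⊓ LinearMap.ker (D.S (n + 1)) := by
  rw [N, S, stage_succ]; rfl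

theorem R_succ (n : ℕ) : D.R (n + 1) = (D.N n).map (D.S (n + 1)) := by
  rw [R, S, stage_succ]; rfl

theorem Q_eq {n : ℕ} (hn : 1 ≤ n) : D.Q n = splitProj D.R D.Rc n := by
  obtain ⟨n, rfl⟩ : ∃ l, n = l + 1 := ⟨n - 1, by omega⟩
  have e : (⨆ i ∈ Finset.Icc 1 n, (history L D.Nc D.Rc n i).R) =
      ⨆ i ∈ Finset.Ico 1 (n + 1), D.R i := by
    refine iSup_congr fun i => ?_
    simp only [Finset.mem_Icc, Finset.mem_Ico, Nat.lt_succ_iff]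
    refine iSup_congr fun hi => ?_
    rw [history_eq_stage _ _ _ hi.2, R]
  rw [splitProj, ← e, R, Q, stage_succ]
  rfl

theorem T_eq {n : ℕ} (hn : 1 ≤ n) : D.T n = invOn (D.S n) (D.Nc n) (D.R n) ∘ₗ
    projOnto (D.R n) ((⨆ j ∈ Finset.Ico 1 n, D.R j) ⊔ D.Rc n) := by
  obtain ⟨n, rfl⟩ : ∃ l, n = l + 1 := ⟨n - 1, by omega⟩
  have e : (⨆ i ∈ Finset.Icc 1 n, (history L D.Nc D.Rc n i).R) =
      ⨆ i ∈ Finset.Ico 1 (n + 1), D.R i := by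
    refine iSup_congr fun i => ?_
    simp only [Finset.mem_Icc, Finset.mem_Ico, Nat.lt_succ_iff]
    refine iSup_congr fun hi => ?_
    rw [history_eq_stage _ _ _ hi.2, R]
  rw [← e, R, S, T, stage_succ]
  rfl

theorem E_self {n : ℕ} (hn : 1 ≤ n) : D.E n n = LinearMap.id := by
  obtain ⟨n, rfl⟩ : ∃ l, n = l + 1 := ⟨n - 1, by omega⟩
  rw [E, stage_succ]
  simp only [step]
  rw [colE, if_pos rfl]

theorem E_of_lt {i n : ℕ} (hi : i < n) :
    D.E i n = -(D.T i ∘ₗ ∑ v ∈ Finset.Icc (i + 1) n, D.Sbar v ∘ₗ D.E v n) := by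
  obtain ⟨n, rfl⟩ : ∃ l, n = l + 1 := ⟨n - 1, by omega⟩
  rw [E, stage_succ]
  simp only [step]
  rw [colE, if_neg (by omega), if_pos hi, history_eq_stage _ _ _ (by omega), T]
  congr 2
  rw [← Finset.sum_attach (Finset.Icc (i + 1) (n + 1))]
  refine Finset.sum_congr rfl fun v _ => ?_
  have hv := Finset.mem_Icc.1 v.2
  congr 1
  · by_cases hvn : v.1 = n + 1
    · rw [if_pos hvn]
      rw [hvn, Sbar, stage_succ]; rfl
    · rw [if_neg hvn, history_eq_stage _ _ _ (by omega), Sbar]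
  · rw [E, stage_succ]; rfl

theorem M_one {n : ℕ} (hn : 1 ≤ n) : D.M 1 n = D.E 1 n := by
  obtain ⟨n, rfl⟩ : ∃ l, n = l + 1 := ⟨n - 1, by omega⟩
  rw [M, E, stage_succ]; rfl

theorem M_of_two_le {i n : ℕ} (hi : 2 ≤ i) (hn : 1 ≤ n) :
    D.M i n = ∑ j ∈ Finset.Icc i n, D.M (i - 1) (j - 1) ∘ₗ D.E j n := by
  obtain ⟨n, rfl⟩ : ∃ l, n = l + 1 := ⟨n - 1, by omega⟩
  rw [M, stage_succ]
  simp only [step]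
  rw [if_neg (by omega)]
  refine Finset.sum_congr rfl fun j hj => ?_
  have hj := Finset.mem_Icc.1 hj
  rw [history_eq_stage _ _ _ (by omega), M, E, stage_succ]
  rfl

theorem isSplitting_R : IsSplitting D.R D.Rc := ⟨D.Rc_zero, D.disjoint_R, D.sup_R⟩

theorem isSplitting_N : IsSplitting D.Nc D.N := ⟨D.N_zero, D.disjoint_N, D.sup_N⟩

theorem P_eq (n : ℕ) : D.P n = splitProj D.Nc D.N n := rfl

theorem S_mem_Rc (n : ℕ) (x : X) : D.S (n + 1) x ∈ D.Rc n := by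
  have := D.isSplitting_R.sub_sum_mem n (D.Sbar (n + 1) x)
  rw [S_succ]
  simp only [LinearMap.comp_apply, LinearMap.sub_apply, LinearMap.id_apply, LinearMap.sum_apply]
  rwa [Finset.sum_congr rfl fun i hi => by rw [D.Q_eq (Finset.mem_Icc.1 hi).1]]

theorem N_le_ker {i n : ℕ} (hi : 1 ≤ i) (hin : i ≤ n) : D.N n ≤ LinearMap.ker (D.S i) := by
  obtain ⟨i, rfl⟩ : ∃ l, i = l + 1 := ⟨i - 1, by omega⟩
  refine (D.isSplitting_N.antitone hin).trans ?_
  rw [N_succ]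
  exact inf_le_right

theorem map_Nc (n : ℕ) : (D.Nc (n + 1)).map (D.S (n + 1)) = D.R (n + 1) := by
  rw [R_succ, ← D.isSplitting_N.sup n, Submodule.map_sup,
    LinearMap.le_ker_iff_map.1 (D.N_le_ker (by omega) le_rfl), sup_bot_eq]

/-- This guarantees that `invOn` inside `T` is a true inverse and not its default. A kernel vector
in `Nᶜₙ₊₁` lies in `Nₙ₊₁`, hence is zero. -/
theorem bijective_S (n : ℕ) : ∃ hm : ∀ x ∈ D.Nc (n + 1), D.S (n + 1) x ∈ D.R (n + 1),
    Function.Bijective ((D.S (n + 1)).restrict hm) := by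
  have hm : ∀ x ∈ D.Nc (n + 1), D.S (n + 1) x ∈ D.R (n + 1) := fun x hx => by
    rw [← map_Nc]; exact Submodule.mem_map_of_mem hx
  refine ⟨hm, ?_, ?_⟩
  · rw [← LinearMap.ker_eq_bot, LinearMap.ker_eq_bot']
    rintro ⟨x, hx⟩ h
    have h0 : D.S (n + 1) x = 0 := congrArg Subtype.val h
    have hxN : x ∈ D.N (n + 1) := by
      rw [N_succ]
      exact ⟨D.isSplitting_N.le_of_lt (Nat.lt_succ_self n) hx, h0⟩
    exact Subtype.ext ((Submodule.disjoint_def.1 (D.isSplitting_N.disjoint n)) x hx hxN)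
  · rintro ⟨y, hy⟩
    rw [← map_Nc] at hy
    obtain ⟨x, hx, rfl⟩ := hy
    exact ⟨⟨x, hx⟩, rfl⟩

theorem T_mem {n : ℕ} (hn : 1 ≤ n) (y : Y) : D.T n y ∈ D.Nc n := by
  rw [T_eq D hn]; exact mapsTo_invOn _

theorem S_T {n : ℕ} (hn : 1 ≤ n) (y : Y) : D.S n (D.T n y) = D.Q n y := by
  obtain ⟨m, rfl⟩ : ∃ l, n = l + 1 := ⟨n - 1, by omega⟩
  obtain ⟨hm, hb⟩ := D.bijective_S m
  rw [T_eq D hn, LinearMap.comp_apply, apply_invOn hm hb, Q_eq D hn]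
  rfl

theorem eq_of_S_eq {n : ℕ} (hn : 1 ≤ n) {x x' : X} (hx : x ∈ D.Nc n) (hx' : x' ∈ D.Nc n)
    (h : D.S n x = D.S n x') : x = x' := by
  obtain ⟨m, rfl⟩ : ∃ l, n = l + 1 := ⟨n - 1, by omega⟩
  obtain ⟨hm, hb⟩ := D.bijective_S m
  exact congrArg Subtype.val (@hb.1 ⟨x, hx⟩ ⟨x', hx'⟩ (Subtype.ext h))

theorem Q_of_mem {n : ℕ} (hn : 1 ≤ n) {y : Y} (hy : y ∈ D.R n) : D.Q n y = y := by
  rw [Q_eq D hn]; exact D.isSplitting_R.splitProj_of_mem hn hy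

theorem S_mem_R {n : ℕ} (hn : 1 ≤ n) {x : X} (hx : x ∈ D.N (n - 1)) : D.S n x ∈ D.R n := by
  obtain ⟨m, rfl⟩ : ∃ l, n = l + 1 := ⟨n - 1, by omega⟩
  rw [R_succ]
  exact Submodule.mem_map_of_mem hx

theorem Nc_le {n : ℕ} (hn : 1 ≤ n) : D.Nc n ≤ D.N (n - 1) :=
  D.isSplitting_N.le_of_lt (by omega)

theorem T_S {n : ℕ} (hn : 1 ≤ n) {x : X} (hx : x ∈ D.Nc n) : D.T n (D.S n x) = x :=
  D.eq_of_S_eq hn (D.T_mem hn _) hx <| by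
    rw [D.S_T hn, D.Q_of_mem hn (D.S_mem_R hn (D.Nc_le hn hx))]

theorem T_eq_zero {n : ℕ} (hn : 1 ≤ n) {y : Y} (hy : D.Q n y = 0) : D.T n y = 0 :=
  D.eq_of_S_eq hn (D.T_mem hn _) (Submodule.zero_mem _) <| by rw [D.S_T hn, hy, map_zero]

theorem Q_Q {i n : ℕ} (hi : 1 ≤ i) (hn : 1 ≤ n) (y : Y) :
    D.Q n (D.Q i y) = if i = n then D.Q n y else 0 := by
  rw [D.Q_eq hi, D.Q_eq hn]; exact D.isSplitting_R.splitProj_splitProj hi hn y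

/-- `Sᵢ` differs from `S̄ᵢ` by components in `R_l` with `l < i`, which `𝒫ⱼ` does not see for `j ≥
i`. -/
theorem Q_Sbar {i j : ℕ} (hi : 1 ≤ i) (hij : i ≤ j) (x : X) :
    D.Q j (D.Sbar i x) = D.Q j (D.S i x) := by
  obtain ⟨i, rfl⟩ : ∃ l, i = l + 1 := ⟨i - 1, by omega⟩
  rw [S_succ]
  simp only [LinearMap.comp_apply, LinearMap.sub_apply, LinearMap.id_apply, LinearMap.sum_apply,
    map_sub, map_sum]
  rw [Finset.sum_eq_zero, sub_zero]
  intro l hl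
  have hl := Finset.mem_Icc.1 hl
  rw [D.Q_Q hl.1 (by omega), if_neg (by omega)]

theorem Sbar_eq {i : ℕ} (hi : 1 ≤ i) (x : X) :
    D.Sbar i x = D.S i x + ∑ l ∈ Finset.Icc 1 (i - 1), D.Q l (D.Sbar i x) := by
  obtain ⟨i, rfl⟩ : ∃ l, i = l + 1 := ⟨i - 1, by omega⟩
  rw [S_succ]
  simp

end Recursion

end Recursion


/-! ### The series `S(ε) = L(ε) φ(ε)` -/

section Recursion

variable {𝕜 X Y : Type*} [Field 𝕜] [AddCommGroup X] [Module 𝕜 X] [AddCommGroup Y] [Module 𝕜 Y]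

namespace Recursion

variable {L : ℕ → X →ₗ[𝕜] Y} (D : Recursion L)

theorem E_mem {i n : ℕ} (hi : 1 ≤ i) (hin : i < n) (x : X) : D.E i n x ∈ D.Nc i := by
  rw [D.E_of_lt hin]
  exact Submodule.neg_mem _ (D.T_mem hi _)

theorem M_self {n : ℕ} (hn : 1 ≤ n) : D.M n n = LinearMap.id := by
  induction n, hn using Nat.le_induction with
  | base => rw [D.M_one le_rfl, D.E_self le_rfl]
  | succ n hn ih =>
    rw [D.M_of_two_le (by omega) (by omega), Finset.Icc_self, Finset.sum_singleton,
      D.E_self (by omega)]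
    simpa using ih

/-- The tail `∑_{v ≥ i} S̄_v E_{v,n}` is annihilated by `𝒫ⱼ` for `i ≤ j < n`. -/
theorem Q_sum_Sbar_E {i j n : ℕ} (hi : 1 ≤ i) (hij : i ≤ j) (hjn : j < n) (x : X) :
    D.Q j (∑ v ∈ Finset.Icc i n, D.Sbar v (D.E v n x)) = 0 := by
  obtain ⟨d, rfl⟩ : ∃ d, j = i + d := ⟨j - i, by omega⟩
  induction d generalizing i with
  | zero =>
    -- For `i = j` the leading term contributes `𝒫ᵢ Sᵢ E_{i,n} = -𝒫ᵢ (tail)`, which cancels the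
    -- tail.
    rw [← Finset.insert_Icc_add_one_left_eq_Icc (by omega), Finset.sum_insert (by simp),
      map_add, D.Q_Sbar hi (by omega), D.E_of_lt (by omega)]
    simp only [LinearMap.neg_apply, LinearMap.comp_apply, map_neg, LinearMap.sum_apply]
    rw [D.S_T hi, D.Q_Q hi (by omega), if_pos (by omega)]
    simp
  | succ d ih =>
    -- For `i < j` the leading term takes its relevant part in `Rᵢ`, where `𝒫ⱼ` vanishes; only the
    -- tail from `i + 1` remains.
    rw [← Finset.insert_Icc_add_one_left_eq_Icc (by omega), Finset.sum_insert (by simp),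
      map_add, D.Q_Sbar hi (by omega), D.E_of_lt (by omega)]
    simp only [LinearMap.neg_apply, LinearMap.comp_apply, map_neg]
    rw [D.S_T hi, D.Q_Q hi (by omega), if_neg (by omega), neg_zero, zero_add]
    have := ih (i := i + 1) (by omega) (by omega) (by omega)
    rwa [show i + 1 + d = i + (d + 1) by omega] at this

theorem Sbar_T_mem {v n : ℕ} (hv : 1 ≤ v) (hvn : v ≤ n) (y : Y) :
    D.Sbar v (D.T v y) ∈ ⨆ i ∈ Finset.Icc 1 n, D.R i := by
  have hQ : ∀ l ∈ Finset.Icc 1 n, ∀ z, D.Q l z ∈ ⨆ i ∈ Finset.Icc 1 n, D.R i := fun l hl z => by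
    refine Submodule.mem_iSup_of_mem l (Submodule.mem_iSup_of_mem hl ?_)
    rw [D.Q_eq (Finset.mem_Icc.1 hl).1]
    exact splitProj_mem _ _ _ _
  rw [D.Sbar_eq hv, D.S_T hv]
  refine Submodule.add_mem _ (hQ _ (by simp; omega) _) (Submodule.sum_mem _ fun l hl => ?_)
  have := Finset.mem_Icc.1 hl
  exact hQ _ (by simp; omega) _

theorem sum_Q_of_mem {n : ℕ} {y : Y} (hy : y ∈ ⨆ i ∈ Finset.Icc 1 n, D.R i) :
    ∑ i ∈ Finset.Icc 1 n, D.Q i y = y := by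
  rw [Finset.sum_congr rfl fun i hi => by rw [D.Q_eq (Finset.mem_Icc.1 hi).1]]
  exact D.isSplitting_R.sum_splitProj_of_mem hy

/-- The sum is `S̄ₙ x` plus a vector of `R₁ ⊕ ⋯ ⊕ Rₙ₋₁`, and it is annihilated by `𝒫₁, …, 𝒫ₙ₋₁`.
Hence it is the image of `S̄ₙ x` under `I - 𝒫₁ - ⋯ - 𝒫ₙ₋₁`. -/
theorem sum_Sbar_E {n : ℕ} (hn : 1 ≤ n) (x : X) :
    ∑ v ∈ Finset.Icc 1 n, D.Sbar v (D.E v n x) = D.S n x := by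
  obtain ⟨n, rfl⟩ : ∃ l, n = l + 1 := ⟨n - 1, by omega⟩
  set w := ∑ v ∈ Finset.Icc 1 (n + 1), D.Sbar v (D.E v (n + 1) x) with hw
  have hQ : ∑ j ∈ Finset.Icc 1 n, D.Q j w = 0 := Finset.sum_eq_zero fun j hj => by
    have := Finset.mem_Icc.1 hj
    exact D.Q_sum_Sbar_E le_rfl this.1 (by omega) x
  have hsplit : w = (∑ v ∈ Finset.Icc 1 n, D.Sbar v (D.E v (n + 1) x)) + D.Sbar (n + 1) x := by
    rw [hw, Finset.sum_Icc_succ_top (by omega), D.E_self (by omega)]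
    rfl
  have hmem : (∑ v ∈ Finset.Icc 1 n, D.Sbar v (D.E v (n + 1) x)) ∈
      ⨆ i ∈ Finset.Icc 1 n, D.R i := Submodule.sum_mem _ fun v hv => by
    have := Finset.mem_Icc.1 hv
    rw [D.E_of_lt (by omega), LinearMap.neg_apply, LinearMap.comp_apply, map_neg]
    exact Submodule.neg_mem _ (D.Sbar_T_mem this.1 this.2 _)
  have h1 := D.sum_Q_of_mem hmem
  rw [D.S_succ]
  simp only [LinearMap.comp_apply, LinearMap.sub_apply, LinearMap.id_apply, LinearMap.sum_apply]
  rw [eq_sub_of_add_eq' hsplit.symm]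
  simp only [map_sub, Finset.sum_sub_distrib]
  rw [h1, hQ]
  abel

/-- Expand `M_{i,n}` by its recursion and exchange the sums: for fixed `j` the sum over `i` is the
definition of `S̄ⱼ`. -/
theorem sum_L_M_eq_sum_Sbar_E {n : ℕ} (hn : 1 ≤ n) (x : X) :
    ∑ i ∈ Finset.Icc 1 n, L (i - 1) (D.M i n x) =
      ∑ v ∈ Finset.Icc 1 n, D.Sbar v (D.E v n x) := by
  rw [← Finset.insert_Icc_add_one_left_eq_Icc hn, Finset.sum_insert (by simp),
    Finset.sum_insert (by simp), D.M_one hn, D.Sbar_one]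
  congr 1
  have h1 : ∀ i ∈ Finset.Icc (1 + 1) n, L (i - 1) (D.M i n x) =
      ∑ j ∈ Finset.Icc i n, L (i - 1) (D.M (i - 1) (j - 1) (D.E j n x)) := fun i hi => by
    rw [D.M_of_two_le (Finset.mem_Icc.1 hi).1 hn]
    simp
  have h2 : ∀ j ∈ Finset.Icc (1 + 1) n, D.Sbar j (D.E j n x) =
      ∑ i ∈ Finset.Icc (1 + 1) j, L (i - 1) (D.M (i - 1) (j - 1) (D.E j n x)) := fun j hj => by
    obtain ⟨j, rfl⟩ : ∃ l, j = l + 1 := ⟨j - 1, by have := Finset.mem_Icc.1 hj; omega⟩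
    rw [D.Sbar_succ (by have := Finset.mem_Icc.1 hj; omega), LinearMap.sum_apply]
    refine Finset.sum_nbij' (· + 1) (· - 1) ?_ ?_ ?_ ?_ ?_ <;>
      (intro i hi; simp only [Finset.mem_Icc] at *) <;> first | omega | rfl
  rw [Finset.sum_congr rfl h1, Finset.sum_congr rfl h2]
  exact Finset.sum_comm' fun i j => by simp only [Finset.mem_Icc]; omega

/-- `M_{i,n}` and `M_{i-1,n-1}` differ by terms with values in the spaces `Nᶜⱼ`. -/
theorem M_succ {i n : ℕ} (hi : 1 ≤ i) (hin : i ≤ n) (x : X) :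
    D.M (i + 1) (n + 1) x = D.M i n x +
      ∑ j ∈ Finset.Icc (i + 1) n, D.M i (j - 1) (D.E j (n + 1) x) := by
  rw [D.M_of_two_le (by omega) (by omega), LinearMap.sum_apply,
    Finset.sum_Icc_succ_top (by omega), D.E_self (by omega), add_comm]
  rfl

/-- Induction on the shift. The corrections from `M_succ`, grouped by `j`, are again sums of the
shape in the statement, so the induction hypothesis evaluates each group as `S_{j-(m+1)} E_{j,n+m+1}
x`. This is zero because `E_{j,n+m+1} x ∈ Nᶜⱼ ⊆ Nⱼ₋₁`. -/
theorem sum_L_M {n : ℕ} (hn : 1 ≤ n) (m : ℕ) (x : X) :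
    ∑ i ∈ Finset.Icc 1 n, L (i - 1) (D.M (i + m) (n + m) x) = D.S n x := by
  induction m generalizing n x with
  | zero =>
    rw [← D.sum_Sbar_E hn, ← D.sum_L_M_eq_sum_Sbar_E hn]
    rfl
  | succ m ih =>
    have h1 : ∀ i ∈ Finset.Icc 1 n, L (i - 1) (D.M (i + (m + 1)) (n + (m + 1)) x) =
        L (i - 1) (D.M (i + m) (n + m) x) + ∑ j ∈ Finset.Icc (i + m + 1) (n + m),
          L (i - 1) (D.M (i + m) (j - 1) (D.E j (n + m + 1) x)) := fun i hi => by
      have := Finset.mem_Icc.1 hi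
      rw [← add_assoc, ← add_assoc, D.M_succ (by omega) (by omega), map_add, map_sum]
    rw [Finset.sum_congr rfl h1, Finset.sum_add_distrib, ih hn, add_eq_left,
      Finset.sum_comm' (t' := Finset.Icc (m + 2) (n + m)) (s' := fun j => Finset.Icc 1 (j - (m + 1)))
        (fun i j => by simp only [Finset.mem_Icc]; omega)]
    refine Finset.sum_eq_zero fun j hj => ?_
    have hj := Finset.mem_Icc.1 hj
    have h2 := ih (n := j - (m + 1)) (by omega) (D.E j (n + m + 1) x)
    rw [show j - (m + 1) + m = j - 1 by omega] at h2
    rw [h2]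
    exact D.N_le_ker (by omega) (by omega : j - (m + 1) ≤ j - 1)
      (D.Nc_le (by omega) (D.E_mem (by omega) (by omega) x))

/-- The coefficients of `L(ε) φ(ε)`. -/
theorem sum_L_phi (k n : ℕ) (x : X) :
    ∑ i ∈ Finset.range (n + 1), L i (D.M (i + 1 + k) (n + 1 + k) x) = D.S (n + 1) x := by
  rw [← D.sum_L_M (by omega) k]
  refine Finset.sum_nbij' (· + 1) (· - 1) ?_ ?_ ?_ ?_ ?_ <;>
    (intro i hi; simp only [Finset.mem_Icc, Finset.mem_range] at *) <;> first | omega | rfl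

/-! ### Chains -/

/-- The coefficient of `εʲ` in `L(ε) b(ε)`. -/
def coeffAt (L : ℕ → X →ₗ[𝕜] Y) (b : ℕ → X) (j : ℕ) : Y :=
  ∑ i ∈ Finset.range (j + 1), L i (b (j - i))

theorem coeffAt_sub (L : ℕ → X →ₗ[𝕜] Y) (b c : ℕ → X) (j : ℕ) :
    coeffAt L (fun i => b i - c i) j = coeffAt L b j - coeffAt L c j := by
  simp [coeffAt]

theorem coeffAt_shift (L : ℕ → X →ₗ[𝕜] Y) {b : ℕ → X} (hb : b 0 = 0) (j : ℕ) :
    coeffAt L (fun i => b (i + 1)) j = coeffAt L b (j + 1) := by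
  rw [coeffAt, coeffAt, Finset.sum_range_succ _ (j + 1), Nat.sub_self, hb, map_zero, add_zero]
  refine Finset.sum_congr rfl fun i hi => ?_
  have := Finset.mem_range.1 hi
  rw [show j + 1 - i = j - i + 1 by omega]

/-- The comparison series for chains: it starts at `x` since `M_{m,m} = I`, and its coefficients
under `L(ε)` do not depend on `m`. -/
theorem coeffAt_M {j m : ℕ} (hj : j < m) (x : X) :
    coeffAt L (fun i => D.M (m - i) m x) j = D.S (j + 1) x := by
  rw [coeffAt, ← D.sum_L_phi (m - (j + 1)) j]
  refine Finset.sum_congr rfl fun i hi => ?_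
  have := Finset.mem_range.1 hi
  rw [show m - (j - i) = i + 1 + (m - (j + 1)) by omega, show j + 1 + (m - (j + 1)) = m by omega]

theorem chain_of_mem {n : ℕ} {x : X} (hx : x ∈ D.N n) :
    ∃ b : ℕ → X, b 0 = x ∧ IsChain L n b := by
  rcases Nat.eq_zero_or_pos n with rfl | hn
  · exact ⟨fun _ => x, rfl, fun j hj => by omega⟩
  · refine ⟨fun i => D.M (n - i) n x, by simp [D.M_self hn], fun j hj => ?_⟩
    exact (D.coeffAt_M hj x).trans (D.N_le_ker (by omega) (by omega) hx)

/-- The second conclusion is what makes the induction run. Subtracting the comparison series gives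
`c` with `c 0 = 0`, and dividing by `ε` gives a shorter chain. Its first uncontrolled coefficient,
`-Sₘ b₀`, lies in `R₁ ⊕ ⋯ ⊕ Rₘ₋₁` by induction but also in `Rᶜₘ₋₁`, so it vanishes. -/
theorem mem_of_chain {m : ℕ} {b : ℕ → X} (hb : IsChain L m b) :
    b 0 ∈ D.N m ∧ coeffAt L b m ∈ ⨆ i ∈ Finset.Icc 1 (m + 1), D.R i := by
  induction m using Nat.strong_induction_on generalizing b with
  | _ m ih =>
    rcases Nat.eq_zero_or_pos m with rfl | hm
    · refine ⟨by simp [D.N_zero], ?_⟩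
      have hR := D.S_mem_R (n := 1) le_rfl (x := b 0) (by simp [D.N_zero])
      have h1 := D.sum_Sbar_E le_rfl (b 0)
      simp only [Finset.Icc_self, Finset.sum_singleton, D.E_self le_rfl, D.Sbar_one,
        LinearMap.id_apply] at h1
      simpa [coeffAt, h1] using hR
    · have hb' : ∀ j < m, coeffAt L b j = 0 := hb
      -- The column `m + 1`, not `m`, so that the coefficient of order `m` is controlled too.
      set c : ℕ → X := fun i => b i - D.M (m + 1 - i) (m + 1) (b 0) with hc
      have hc0 : c 0 = 0 := by simp [hc, D.M_self]
      have hcj : ∀ j ≤ m, coeffAt L c j = coeffAt L b j - D.S (j + 1) (b 0) := fun j hj => by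
        rw [hc, coeffAt_sub, D.coeffAt_M (by omega)]
      have hN1 : b 0 ∈ D.N (m - 1) :=
        (ih (m - 1) (by omega) (b := b) fun j hj => hb j (by omega)).1
      have hcz : ∀ j < m - 1, coeffAt L c j = 0 := fun j hj => by
        rw [hcj j (by omega), hb' j (by omega), zero_sub, neg_eq_zero]
        exact D.N_le_ker (by omega) (by omega) hN1
      have hSR : D.S m (b 0) ∈ ⨆ i ∈ Finset.Icc 1 (m - 1), D.R i := by
        -- For `m = 1` there is no shorter chain to use; the chain condition itself gives `S₁ b₀ =
        -- 0`.
        rcases Nat.lt_or_ge m 2 with h2 | h2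
        · obtain rfl : m = 1 := by omega
          have : coeffAt L b 0 = D.S 1 (b 0) := by
            have := hcj 0 (by omega)
            rw [eq_comm, sub_eq_iff_eq_add] at this
            simpa [coeffAt, hc0] using this
          rw [← this, hb' 0 (by omega)]
          exact Submodule.zero_mem _
        · have := (ih (m - 2) (by omega) (b := fun i => c (i + 1)) fun j hj =>
            (coeffAt_shift L hc0 j).trans (hcz (j + 1) (by omega))).2
          rw [coeffAt_shift L hc0, hcj _ (by omega), hb' _ (by omega), zero_sub,
            show m - 2 + 1 + 1 = m by omega, show m - 2 + 1 = m - 1 by omega] at this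
          exact (Submodule.neg_mem_iff _).1 this
      have hS0 : D.S m (b 0) = 0 := by
        refine D.isSplitting_R.eq_zero_of_mem hSR ?_
        have := D.S_mem_Rc (m - 1) (b 0)
        rwa [show m - 1 + 1 = m by omega] at this
      have hN : b 0 ∈ D.N m := by
        have h := D.N_succ (m - 1)
        rw [show m - 1 + 1 = m by omega] at h
        rw [h]
        exact ⟨hN1, hS0⟩
      refine ⟨hN, ?_⟩
      -- Now that `Sₘ b₀ = 0`, the shifted series is a chain that is longer by one than the previous
      -- one.
      have hch := (ih (m - 1) (by omega) (b := fun i => c (i + 1)) fun j hj => by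
        refine (coeffAt_shift L hc0 j).trans ?_
        rw [hcj _ (by omega), hb' _ (by omega), zero_sub, neg_eq_zero]
        exact D.N_le_ker (by omega) (by omega) hN).2
      rw [coeffAt_shift L hc0, show m - 1 + 1 = m by omega, hcj _ le_rfl] at hch
      have hmono : (⨆ i ∈ Finset.Icc 1 m, D.R i) ≤ ⨆ i ∈ Finset.Icc 1 (m + 1), D.R i :=
        biSup_mono fun i hi => by simp only [Finset.mem_Icc] at *; omega
      have hR : D.S (m + 1) (b 0) ∈ ⨆ i ∈ Finset.Icc 1 (m + 1), D.R i :=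
        Submodule.mem_iSup_of_mem (m + 1) (Submodule.mem_iSup_of_mem (by simp)
          (D.S_mem_R (by omega) hN))
      simpa using Submodule.add_mem _ (hmono hch) hR

theorem mem_N_iff {n : ℕ} {x : X} : x ∈ D.N n ↔ ∃ b : ℕ → X, b 0 = x ∧ IsChain L n b :=
  ⟨D.chain_of_mem, fun ⟨_, h0, hb⟩ => h0 ▸ (D.mem_of_chain hb).1⟩

theorem le_rank_iff {n : ℕ} {x : X} : (n : ℕ∞) ≤ rank L x ↔ x ∈ D.N n := by
  rcases Nat.eq_zero_or_pos n with rfl | hn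
  · simp [D.N_zero]
  have hL : D.S 1 = L 0 := by
    ext x
    simpa [D.E_self le_rfl, D.Sbar_one] using (D.sum_Sbar_E le_rfl x).symm
  constructor
  · intro h
    by_cases h0 : L 0 x = 0
    · rw [rank, if_neg (by simpa using h0)] at h
      -- A strict inequality below the supremum yields an actual chain, of length at least `n`.
      have hlt : ((n - 1 : ℕ) : ℕ∞) < ⨆ m ∈ {m : ℕ | 1 ≤ m ∧ ∃ b : ℕ → X, b 0 = x ∧ IsChain L m b},
          (m : ℕ∞) := lt_of_lt_of_le (by exact_mod_cast (by omega : n - 1 < n)) h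
      obtain ⟨m, hm⟩ := lt_iSup_iff.1 hlt
      obtain ⟨hmem, hm⟩ := lt_iSup_iff.1 hm
      have hm : n - 1 < m := by exact_mod_cast hm
      exact D.isSplitting_N.antitone (by omega : n ≤ m) (D.mem_N_iff.2 hmem.2)
    · rw [rank, if_pos h0] at h
      have : n ≤ 0 := by exact_mod_cast h
      omega
  · intro h
    have h0 : L 0 x = 0 := by rw [← hL]; exact D.N_le_ker le_rfl hn h
    rw [rank, if_neg (by simpa using h0)]
    exact le_iSup₂_of_le (f := fun (m : ℕ) _ => (m : ℕ∞)) n ⟨hn, D.mem_N_iff.1 h⟩ le_rfl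

end Recursion

end Recursion


/-! ### Consequences of stabilization -/

section Recursion

variable {𝕜 X Y : Type*} [Field 𝕜] [AddCommGroup X] [Module 𝕜 X] [AddCommGroup Y] [Module 𝕜 Y]

namespace Recursion

variable {L : ℕ → X →ₗ[𝕜] Y} (D : Recursion L)

theorem T_S_of_mem {i j : ℕ} (hi : 1 ≤ i) (hj : 1 ≤ j) {x : X} (hx : x ∈ D.Nc j) :
    D.T i (D.S j x) = if i = j then x else 0 := by
  split_ifs with h
  · subst h; exact D.T_S hi hx
  · refine D.T_eq_zero hi ?_
    rw [D.Q_eq hi]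
    exact D.isSplitting_R.splitProj_of_mem_ne hj hi (Ne.symm h) (D.S_mem_R hj (D.Nc_le hj hx))

theorem P_mem (n : ℕ) (x : X) : D.P n x ∈ D.Nc n := splitProj_mem _ _ _ _

theorem P_T {i j : ℕ} (hi : 1 ≤ i) (hj : 1 ≤ j) (y : Y) :
    D.P i (D.T j y) = if i = j then D.T j y else 0 := by
  split_ifs with h
  · subst h; exact D.isSplitting_N.splitProj_of_mem hi (D.T_mem hj y)
  · exact D.isSplitting_N.splitProj_of_mem_ne hj hi (Ne.symm h) (D.T_mem hj y)

theorem T_Q {n : ℕ} (hn : 1 ≤ n) (y : Y) : D.T n (D.Q n y) = D.T n y := by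
  have := D.T_eq_zero hn (y := D.Q n y - y) (by rw [map_sub, D.Q_Q hn hn, if_pos rfl, sub_self])
  rwa [map_sub, sub_eq_zero] at this

section Stabilizes

variable {k : ℕ} (hk : StabilizesAt L k)
include hk

/-- No rank lies strictly between `k` and `∞`, so rank at least `k + 1` already means infinite rank.
-/
theorem N_eq_of_le {n : ℕ} (hn : k + 1 ≤ n) : D.N n = D.N (k + 1) := by
  refine le_antisymm (D.isSplitting_N.antitone hn) fun x hx => ?_
  rw [← D.le_rank_iff] at hx ⊢
  rcases hk.1 x with h | h
  · have : k + 1 ≤ k := by exact_mod_cast hx.trans h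
    omega
  · rw [h]; exact le_top

/-- A vector of rank `k` lies in `Nₖ` but not in `Nₖ₊₁`. -/
theorem exists_mem_Nc : ∃ x ∈ D.Nc (k + 1), x ≠ 0 := by
  by_contra! h
  have hbot : D.Nc (k + 1) = ⊥ := (Submodule.eq_bot_iff _).2 h
  have hN := D.isSplitting_N.sup k
  rw [hbot, bot_sup_eq] at hN
  obtain ⟨x, hx⟩ := hk.2
  have h1 : x ∈ D.N k := D.le_rank_iff.1 hx.ge
  rw [← hN, ← D.le_rank_iff, hx] at h1
  have : k + 1 ≤ k := by exact_mod_cast h1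
  omega

theorem T_ne_zero : D.T (k + 1) ≠ 0 := by
  obtain ⟨x, hx, hx0⟩ := D.exists_mem_Nc hk
  intro h
  have := D.T_S (by omega) hx
  rw [h] at this
  exact hx0 this.symm

theorem N_le_ker_S {i : ℕ} (hi : 1 ≤ i) : D.N (k + 1) ≤ LinearMap.ker (D.S i) := by
  rcases Nat.le_total i (k + 1) with h | h
  · exact D.N_le_ker hi h
  · rw [← D.N_eq_of_le hk h]
    exact D.N_le_ker hi le_rfl

theorem Nc_eq_bot {n : ℕ} (hn : k + 2 ≤ n) : D.Nc n = ⊥ := by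
  obtain ⟨n, rfl⟩ : ∃ l, n = l + 1 := ⟨n - 1, by omega⟩
  have h1 := D.isSplitting_N.sup n
  have h2 := D.isSplitting_N.disjoint n
  rw [D.N_eq_of_le hk (by omega : k + 1 ≤ n + 1), ← D.N_eq_of_le hk (by omega : k + 1 ≤ n)] at h1 h2
  rw [← le_bot_iff, ← disjoint_iff.1 h2]
  exact le_inf le_rfl (h1 ▸ le_sup_left)

theorem T_eq_zero_of_le {n : ℕ} (hn : k + 2 ≤ n) : D.T n = 0 := by
  ext y
  have := D.T_mem (by omega : 1 ≤ n) y
  rwa [D.Nc_eq_bot hk hn, Submodule.mem_bot] at this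

theorem Q_eq_zero_of_le {n : ℕ} (hn : k + 2 ≤ n) : D.Q n = 0 := by
  ext y
  rw [← D.S_T (by omega), D.T_eq_zero_of_le hk hn]
  simp

theorem E_eq_zero_of_le {i n : ℕ} (hi : k + 2 ≤ i) (hin : i < n) : D.E i n = 0 := by
  rw [D.E_of_lt hin, D.T_eq_zero_of_le hk hi]
  simp

/-- The corrections in `M_succ` involve only `E_{j,n+1}` with `k + 2 ≤ j ≤ n`, and these vanish.
Hence the single family `φ` describes all `M_{i,n}` with `i ≥ k + 1`. -/
theorem M_succ_of_le {i n : ℕ} (hi : k + 1 ≤ i) (hin : i ≤ n) :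
    D.M (i + 1) (n + 1) = D.M i n := by
  ext x
  rw [D.M_succ (by omega) hin, Finset.sum_eq_zero, add_zero]
  intro j hj
  have hj := Finset.mem_Icc.1 hj
  rw [D.E_eq_zero_of_le hk (by omega) (by omega)]
  simp

theorem M_eq_phi {i n : ℕ} (hi : k + 1 ≤ i) (hin : i ≤ n) : D.M i n = D.phi k (n - i) := by
  induction i, hi using Nat.le_induction generalizing n with
  | base => rw [phi, Nat.add_sub_cancel' hin]
  | succ i hi ih =>
    obtain ⟨n, rfl⟩ : ∃ l, n = l + 1 := ⟨n - 1, by omega⟩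
    rw [D.M_succ_of_le hk hi (by omega), ih (by omega), Nat.add_sub_add_right]

theorem sum_L_comp_phi (n : ℕ) (x : X) :
    ∑ i ∈ Finset.range (n + 1), L i (D.phi k (n - i) x) = D.S (n + 1) x := by
  rw [← D.sum_L_phi k n]
  refine Finset.sum_congr rfl fun i hi => ?_
  have := Finset.mem_range.1 hi
  rw [D.M_eq_phi hk (by omega) (by omega), show n + 1 + k - (i + 1 + k) = n - i by omega]

/-- This is the coefficient of `εⁿ` in `ψ(ε)Δ(ε) = L(ε)φ(ε)`. By `Tⱼ Sᵢ₊₁ Pᵢ₊₁ = 0` for `j ≠ i + 1`,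
each term collapses to `Sₙ₊₁ Pᵢ₊₁ x`. -/
theorem sum_psi_S_P (n : ℕ) (x : X) :
    ∑ i ∈ Finset.range (n + 1),
      D.psi k (n - i) (if i ≤ k then D.S (i + 1) (D.P (i + 1) x) else 0) = D.S (n + 1) x := by
  have h1 : ∀ i ∈ Finset.range (n + 1),
      D.psi k (n - i) (if i ≤ k then D.S (i + 1) (D.P (i + 1) x) else 0) =
        if i ≤ k then D.S (n + 1) (D.P (i + 1) x) else 0 := fun i hi => by
    have hi := Finset.mem_range.1 hi
    by_cases hik : i ≤ k
    · rw [if_pos hik, if_pos hik, psi]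
      by_cases hni : n - i = 0
      · obtain rfl : n = i := by omega
        simp
      · rw [if_neg hni, LinearMap.sum_apply, Finset.sum_eq_single_of_mem (i + 1)
          (Finset.mem_Icc.2 ⟨by omega, by omega⟩)]
        · rw [LinearMap.comp_apply, D.T_S (by omega) (D.P_mem _ _),
            show n - i + (i + 1) = n + 1 by omega]
        · intro j hj hji
          rw [LinearMap.comp_apply, D.T_S_of_mem (Finset.mem_Icc.1 hj).1 (by omega) (D.P_mem _ _),
            if_neg hji, map_zero]
    · rw [if_neg hik, if_neg hik, map_zero]
  have h2 : (Finset.range (n + 1)).filter (· ≤ k) = Finset.range (min n k + 1) := by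
    ext; simp
  rw [Finset.sum_congr rfl h1, ← Finset.sum_filter, h2, ← map_sum, ← sub_eq_zero, ← map_sub,
    ← neg_eq_zero, ← map_neg, neg_sub]
  have h3 : x - ∑ i ∈ Finset.range (min n k + 1), D.P (i + 1) x ∈ D.N (min n k + 1) := by
    have := D.isSplitting_N.sub_sum_mem (min n k + 1) x
    rwa [← Finset.Ico_add_one_right_eq_Icc, Finset.sum_Ico_eq_sum_range, Nat.add_sub_cancel,
      Finset.sum_congr rfl fun i _ => by rw [add_comm 1 i]] at this
  -- The remainder is killed by `Sₙ₊₁` by construction if `n ≤ k`, and by stabilization if `n ≥ k`.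
  rcases Nat.le_total n k with h | h
  · rw [min_eq_left h] at h3 ⊢
    exact D.N_le_ker (by omega) le_rfl h3
  · rw [min_eq_right h] at h3 ⊢
    exact D.N_le_ker_S hk (by omega) h3

end Stabilizes

end Recursion

end Recursion


/-! ### Power series with geometrically bounded coefficients -/

section PowerSeries

open Filter Topology

variable {𝕜 E : Type*} [RCLike 𝕜] [NormedAddCommGroup E] [NormedSpace 𝕜 E]

/-- `‖a n‖` grows at most geometrically. -/
def GeomBdd (a : ℕ → E) : Prop := ∃ K ρ : ℝ, 1 ≤ ρ ∧ ∀ n, ‖a n‖ ≤ K * ρ ^ n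

/-- The terms of a series that converges at one point `ε ≠ 0` are bounded. -/
theorem GeomBdd.of_hasSum {a : ℕ → E} {F : 𝕜 → E}
    (h : ∀ᶠ ε in 𝓝 (0 : 𝕜), HasSum (fun i : ℕ => ε ^ i • a i) (F ε)) : GeomBdd a := by
  obtain ⟨ε, hε, hε0⟩ := ((h.filter_mono nhdsWithin_le_nhds).and
    (self_mem_nhdsWithin : {(0 : 𝕜)}ᶜ ∈ 𝓝[≠] 0)).exists
  have hε0 : 0 < ‖ε‖ := norm_pos_iff.2 hε0
  obtain ⟨K, hK⟩ := hε.summable.tendsto_atTop_zero.norm.bddAbove_range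
  refine ⟨K, max 1 ‖ε‖⁻¹, le_max_left _ _, fun n => ?_⟩
  have h1 : ‖ε‖ ^ n * ‖a n‖ ≤ K := by
    have := hK (Set.mem_range_self n)
    simpa [norm_smul] using this
  have hK0 : 0 ≤ K := le_trans (by positivity) h1
  calc ‖a n‖ = (‖ε‖ ^ n * ‖a n‖) * (‖ε‖⁻¹) ^ n := by
        rw [inv_pow]; field_simp
    _ ≤ K * (‖ε‖⁻¹) ^ n := by gcongr
    _ ≤ K * (max 1 ‖ε‖⁻¹) ^ n := by gcongr; exact le_max_right _ _

theorem GeomBdd.eventually_summable_norm {a : ℕ → E} (h : GeomBdd a) :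
    ∀ᶠ ε in 𝓝 (0 : 𝕜), Summable fun i : ℕ => ‖ε ^ i • a i‖ := by
  obtain ⟨K, ρ, hρ, hK⟩ := h
  have hpos : 0 < ρ⁻¹ := by positivity
  filter_upwards [Metric.ball_mem_nhds (0 : 𝕜) hpos] with ε hε
  rw [mem_ball_zero_iff] at hε
  have h1 : ‖ε‖ * ρ < 1 := by
    rwa [← lt_div_iff₀ (by positivity), one_div]
  refine Summable.of_nonneg_of_le (fun _ => norm_nonneg _) (fun n => ?_)
    ((summable_geometric_of_lt_one (by positivity) h1).mul_left K)
  rw [norm_smul, norm_pow, mul_pow]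
  calc ‖ε‖ ^ n * ‖a n‖ ≤ ‖ε‖ ^ n * (K * ρ ^ n) := by gcongr; exact hK n
    _ = K * (‖ε‖ ^ n * ρ ^ n) := by ring

theorem GeomBdd.exists_analyticAt [CompleteSpace E] {a : ℕ → E} (h : GeomBdd a) :
    ∃ f : 𝕜 → E, AnalyticAt 𝕜 f 0 ∧ f 0 = a 0 ∧
      ∀ᶠ ε in 𝓝 (0 : 𝕜), HasSum (fun i : ℕ => ε ^ i • a i) (f ε) := by
  obtain ⟨K, ρ, hρ, hK⟩ := h
  set p : FormalMultilinearSeries 𝕜 𝕜 E :=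
    fun n => ContinuousMultilinearMap.mkPiRing 𝕜 (Fin n) (a n) with hp
  have hrad : 0 < p.radius := by
    refine lt_of_lt_of_le ?_ (p.le_radius_of_bound (r := Real.toNNReal ρ⁻¹) K fun n => ?_)
    · simp; linarith
    · rw [hp, ContinuousMultilinearMap.norm_mkPiRing, Real.coe_toNNReal _ (by positivity), inv_pow]
      have : 0 < ρ ^ n := by positivity
      rw [← div_eq_mul_inv, div_le_iff₀ this]
      exact hK n
  have hf := p.hasFPowerSeriesOnBall hrad
  have hsum : ∀ᶠ ε in 𝓝 (0 : 𝕜), HasSum (fun i : ℕ => ε ^ i • a i) (p.sum ε) := by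
    filter_upwards [Metric.eball_mem_nhds (0 : 𝕜) hrad] with ε hε
    simpa [hp] using hf.hasSum hε
  refine ⟨p.sum, hf.analyticAt, ?_, hsum⟩
  refine hsum.self_of_nhds.unique ?_
  simpa using hasSum_single (f := fun i : ℕ => (0 : 𝕜) ^ i • a i) 0
    fun i hi => by simp [hi]

theorem GeomBdd.shift {a : ℕ → E} (h : GeomBdd a) (m : ℕ) : GeomBdd fun n => a (n + m) := by
  obtain ⟨K, ρ, hρ, hK⟩ := h
  exact ⟨K * ρ ^ m, ρ, hρ, fun n => (hK _).trans_eq (by ring)⟩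

theorem GeomBdd.of_shift {a : ℕ → E} {m : ℕ} (h : GeomBdd fun n => a (n + m)) : GeomBdd a := by
  obtain ⟨K, ρ, hρ, hK⟩ := h
  have hK0 : 0 ≤ K := by simpa using (norm_nonneg _).trans (hK 0)
  have hS : 0 ≤ ∑ i ∈ Finset.range m, ‖a i‖ := Finset.sum_nonneg fun _ _ => norm_nonneg _
  refine ⟨K + ∑ i ∈ Finset.range m, ‖a i‖, ρ, hρ, fun n => ?_⟩
  have h1 : 1 ≤ ρ ^ n := one_le_pow₀ hρ
  rcases Nat.lt_or_ge n m with hn | hn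
  · have := Finset.single_le_sum (f := fun i => ‖a i‖) (fun _ _ => norm_nonneg _)
      (Finset.mem_range.2 hn)
    nlinarith
  · obtain ⟨d, rfl⟩ : ∃ d, n = d + m := ⟨n - m, by omega⟩
    refine (hK d).trans ?_
    have : ρ ^ d ≤ ρ ^ (d + m) := pow_le_pow_right₀ hρ (by omega)
    nlinarith [pow_pos (by linarith : 0 < ρ) d]

theorem GeomBdd.sum {ι : Type*} {s : Finset ι} {a : ι → ℕ → E} (h : ∀ i ∈ s, GeomBdd (a i)) :
    GeomBdd fun n => ∑ i ∈ s, a i n := by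
  classical
  induction s using Finset.induction_on with
  | empty => exact ⟨0, 1, le_rfl, fun n => by simp⟩
  | insert i s hi ih =>
    obtain ⟨K, ρ, hρ, hK⟩ := h i (Finset.mem_insert_self _ _)
    obtain ⟨K', ρ', hρ', hK'⟩ := ih fun j hj => h j (Finset.mem_insert_of_mem hj)
    have hK0 : 0 ≤ K := by simpa using (norm_nonneg _).trans (hK 0)
    have hK0' : 0 ≤ K' := by simpa using (norm_nonneg _).trans (hK' 0)
    refine ⟨K + K', max ρ ρ', le_max_of_le_left hρ, fun n => ?_⟩
    simp only [Finset.sum_insert hi, add_mul]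
    refine (norm_add_le _ _).trans (add_le_add ((hK n).trans ?_) ((hK' n).trans ?_))
    · gcongr; exact le_max_left _ _
    · gcongr; exact le_max_right _ _

variable {X Y Z : Type*} [NormedAddCommGroup X] [NormedSpace 𝕜 X] [NormedAddCommGroup Y]
  [NormedSpace 𝕜 Y] [NormedAddCommGroup Z] [NormedSpace 𝕜 Z]

theorem GeomBdd.comp {f : ℕ → Y →L[𝕜] Z} {g : ℕ → X →L[𝕜] Y} (hf : GeomBdd f) (hg : GeomBdd g) :
    GeomBdd fun n => ∑ i ∈ Finset.range (n + 1), f i ∘L g (n - i) := by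
  obtain ⟨K, ρ, hρ, hK⟩ := hf
  obtain ⟨K', ρ', hρ', hK'⟩ := hg
  have hK0 : 0 ≤ K := by simpa using (norm_nonneg _).trans (hK 0)
  have hK0' : 0 ≤ K' := by simpa using (norm_nonneg _).trans (hK' 0)
  set σ := max ρ ρ' with hσ
  have hσ1 : 1 ≤ σ := le_max_of_le_left hρ
  -- The factor `2` absorbs the number `n + 1 ≤ 2ⁿ` of terms.
  refine ⟨K * K', 2 * σ, by linarith, fun n => ?_⟩
  have h1 : ∀ i ∈ Finset.range (n + 1), ‖f i ∘L g (n - i)‖ ≤ K * K' * σ ^ n := fun i hi => by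
    have hi := Finset.mem_range.1 hi
    calc ‖f i ∘L g (n - i)‖ ≤ ‖f i‖ * ‖g (n - i)‖ := ContinuousLinearMap.opNorm_comp_le _ _
      _ ≤ (K * σ ^ i) * (K' * σ ^ (n - i)) := by
        gcongr
        · exact (hK i).trans (by gcongr; exact le_max_left _ _)
        · exact (hK' _).trans (by gcongr; exact le_max_right _ _)
      _ = K * K' * (σ ^ i * σ ^ (n - i)) := by ring
      _ = K * K' * σ ^ n := by rw [← pow_add, Nat.add_sub_cancel' (by omega)]
  refine (norm_sum_le_of_le _ h1).trans ?_
  rw [Finset.sum_const, Finset.card_range, nsmul_eq_mul, mul_pow]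
  have h2 : ((n + 1 : ℕ) : ℝ) ≤ 2 ^ n := by exact_mod_cast Nat.lt_two_pow_self (n := n)
  calc ((n + 1 : ℕ) : ℝ) * (K * K' * σ ^ n) ≤ 2 ^ n * (K * K' * σ ^ n) := by gcongr
    _ = _ := by ring

theorem GeomBdd.comp_const {f : ℕ → Y →L[𝕜] Z} (hf : GeomBdd f) (g : X →L[𝕜] Y) :
    GeomBdd fun n => f n ∘L g := by
  obtain ⟨K, ρ, hρ, hK⟩ := hf
  refine ⟨K * ‖g‖, ρ, hρ, fun n => (ContinuousLinearMap.opNorm_comp_le _ _).trans ?_⟩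
  calc ‖f n‖ * ‖g‖ ≤ K * ρ ^ n * ‖g‖ := by gcongr; exact hK n
    _ = _ := by ring

/-- The Cauchy product of two absolutely convergent series of operators. -/
theorem hasSum_comp_range [CompleteSpace Z] {f : ℕ → Y →L[𝕜] Z} {g : ℕ → X →L[𝕜] Y}
    {F : Y →L[𝕜] Z} {G : X →L[𝕜] Y} (hf : HasSum f F) (hg : HasSum g G)
    (nf : Summable fun i => ‖f i‖) (ng : Summable fun i => ‖g i‖) :
    HasSum (fun n => ∑ i ∈ Finset.range (n + 1), f i ∘L g (n - i)) (F ∘L G) := by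
  have hs : Summable fun p : ℕ × ℕ => f p.1 ∘L g p.2 :=
    Summable.of_norm_bounded (nf.mul_of_nonneg ng (fun _ => norm_nonneg _) fun _ => norm_nonneg _)
      fun p => ContinuousLinearMap.opNorm_comp_le _ _
  have h1 : ∀ i, HasSum (fun j => f i ∘L g j) (f i ∘L G) := fun i =>
    (ContinuousLinearMap.compL 𝕜 X Y Z (f i)).hasSum hg
  have h2 : HasSum (fun i => f i ∘L G) (F ∘L G) :=
    ((ContinuousLinearMap.compL 𝕜 X Y Z).flip G).hasSum hf
  have h3 : HasSum (fun p : ℕ × ℕ => f p.1 ∘L g p.2) (F ∘L G) := by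
    have := hs.hasSum
    rwa [(this.prod_fiberwise h1).unique h2] at this
  have h4 := (Finset.HasAntidiagonal.sigmaAntidiagonalEquivProd.hasSum_iff).2 h3
  convert h4.sigma fun n => hasSum_fintype _ using 2 with n
  rw [← Finset.Nat.sum_antidiagonal_eq_sum_range_succ (fun i j => f i ∘L g j)]
  exact (Finset.sum_coe_sort (Finset.HasAntidiagonal.antidiagonal n)
    fun p : ℕ × ℕ => f p.1 ∘L g p.2).symm

theorem hasSum_smul_comp_range [CompleteSpace Z] {f : ℕ → Y →L[𝕜] Z} {g : ℕ → X →L[𝕜] Y}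
    {F : Y →L[𝕜] Z} {G : X →L[𝕜] Y} {ε : 𝕜} (hf : HasSum (fun i : ℕ => ε ^ i • f i) F)
    (hg : HasSum (fun i : ℕ => ε ^ i • g i) G)
    (nf : Summable fun i : ℕ => ‖ε ^ i • f i‖) (ng : Summable fun i : ℕ => ‖ε ^ i • g i‖) :
    HasSum (fun n : ℕ => ε ^ n • ∑ i ∈ Finset.range (n + 1), f i ∘L g (n - i)) (F ∘L G) := by
  convert hasSum_comp_range hf hg nf ng using 2 with n
  rw [Finset.smul_sum]
  refine Finset.sum_congr rfl fun i hi => ?_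
  have hi := Finset.mem_range.1 hi
  rw [ContinuousLinearMap.smul_comp, ContinuousLinearMap.comp_smul, smul_smul, ← pow_add,
    Nat.add_sub_cancel' (by omega)]

end PowerSeries

/-- The growth estimate for the solutions of the recursion: `m i n` bounds `M_{i,n}` and `s n`
bounds `S̄ₙ`. -/
theorem exists_geometric_bound {m : ℕ → ℕ → ℝ} {s : ℕ → ℝ} {k : ℕ} {K₀ r h : ℝ}
    (hm : ∀ i n, 0 ≤ m i n) (hK₀ : 0 ≤ K₀) (hr : 1 ≤ r) (hh : 0 ≤ h)
    (hs : ∀ n, k + 1 ≤ n → s (n + 1) ≤ ∑ i ∈ Finset.Icc 1 n, K₀ * r ^ i * m i n)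
    (hone : ∀ n, k + 1 ≤ n → m 1 (n + 1) ≤ h * s (n + 1))
    (hsucc : ∀ i n, 1 ≤ i → i ≤ k → k + 1 ≤ n → m (i + 1) (n + 1) ≤ m i n + h * s (n + 1))
    (hconst : ∀ i n, k + 1 ≤ i → i ≤ n → m (i + 1) (n + 1) = m i n) :
    ∃ K ρ : ℝ, 1 ≤ ρ ∧ ∀ n, m (k + 1) (k + 1 + n) ≤ K * ρ ^ n := by
  set C := K₀ * r ^ (k + 1) * 2 ^ (k + 1) with hC
  have hC0 : 0 ≤ C := by positivity
  -- `2r ≤ ρ` makes the sum over `i` geometric with ratio `1/2`; `1 + hC ≤ ρ` absorbs one step of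
  -- the recursion.
  set ρ := max (2 * r) (1 + h * C) with hρ
  have hρ2 : 2 * r ≤ ρ := le_max_left _ _
  have hρC : 1 + h * C ≤ ρ := le_max_right _ _
  have hρ1 : 1 ≤ ρ := by linarith
  set K := ∑ i ∈ Finset.Icc 1 (k + 1), m i (k + 1) with hK
  have hK0 : 0 ≤ K := Finset.sum_nonneg fun _ _ => hm _ _
  -- Truncated subtraction matters: the exponent is `n` for `i ≤ k + 1`, and beyond that it is
  -- constant along diagonals, as `hconst` demands.
  have key : ∀ n, k + 1 ≤ n → ∀ i, 1 ≤ i → i ≤ n → m i n ≤ K * ρ ^ (n - (i - (k + 1))) := by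
    intro n hn
    induction n, hn using Nat.le_induction with
    | base =>
      intro i hi hik
      have h1 : m i (k + 1) ≤ K :=
        Finset.single_le_sum (f := fun i => m i (k + 1)) (fun _ _ => hm _ _)
          (Finset.mem_Icc.2 ⟨hi, hik⟩)
      exact h1.trans (le_mul_of_one_le_right hK0 (one_le_pow₀ hρ1))
    | succ n hn ih =>
      have hsn : s (n + 1) ≤ C * (K * ρ ^ n) := by
        refine (hs n hn).trans ?_
        have hterm : ∀ i ∈ Finset.Icc 1 n, K₀ * r ^ i * m i n ≤
            C * (K * ρ ^ n) * (1 / 2) ^ i := fun i hi => by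
          have hi := Finset.mem_Icc.1 hi
          set d := i - (k + 1) with hd
          have h1 : r ^ i ≤ r ^ (k + 1) * r ^ d := by
            rw [← pow_add]; exact pow_le_pow_right₀ hr (by omega)
          have h2 : r ^ d * 2 ^ d * ρ ^ (n - d) ≤ ρ ^ n := by
            calc r ^ d * 2 ^ d * ρ ^ (n - d) = (2 * r) ^ d * ρ ^ (n - d) := by
                  rw [mul_pow, mul_comm (r ^ d)]
              _ ≤ ρ ^ d * ρ ^ (n - d) := by gcongr
              _ = ρ ^ n := by rw [← pow_add, Nat.add_sub_cancel' (by omega)]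
          -- The factor `2^(k+1)` in `C` pays for `(1/2)^i` on the range `i ≤ k + 1`, where `d = 0`.
          have h3 : (1 : ℝ) ≤ 2 ^ (k + 1) * 2 ^ d * (1 / 2) ^ i := by
            rw [← pow_add, one_div, inv_pow, ← div_eq_mul_inv, one_le_div (by positivity)]
            exact pow_le_pow_right₀ (by norm_num) (by omega)
          calc K₀ * r ^ i * m i n ≤ K₀ * (r ^ (k + 1) * r ^ d) * (K * ρ ^ (n - d)) := by
                gcongr
                · exact hm _ _
                · exact ih i hi.1 hi.2
            _ ≤ K₀ * (r ^ (k + 1) * r ^ d) * (K * ρ ^ (n - d)) *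
                (2 ^ (k + 1) * 2 ^ d * (1 / 2) ^ i) := le_mul_of_one_le_right (by positivity) h3
            _ = C * (K * (r ^ d * 2 ^ d * ρ ^ (n - d))) * (1 / 2) ^ i := by rw [hC]; ring
            _ ≤ C * (K * ρ ^ n) * (1 / 2) ^ i := by gcongr
        refine (Finset.sum_le_sum hterm).trans ?_
        rw [← Finset.mul_sum]
        refine mul_le_of_le_one_right (by positivity) ?_
        have : ∀ n : ℕ, ∑ i ∈ Finset.Icc 1 n, (1 / 2 : ℝ) ^ i = 1 - (1 / 2) ^ n := fun n => by
          induction n with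
          | zero => simp
          | succ n ih => rw [Finset.sum_Icc_succ_top (by omega), ih, pow_succ]; ring
        rw [this]
        have : (0 : ℝ) < (1 / 2) ^ n := by positivity
        linarith
      have hbound : K * ρ ^ n + h * s (n + 1) ≤ K * ρ ^ (n + 1) := by
        calc K * ρ ^ n + h * s (n + 1) ≤ K * ρ ^ n + h * (C * (K * ρ ^ n)) := by gcongr
          _ = (1 + h * C) * (K * ρ ^ n) := by ring
          _ ≤ ρ * (K * ρ ^ n) := by gcongr
          _ = K * ρ ^ (n + 1) := by ring
      intro i hi hin
      rcases Nat.lt_or_ge (k + 1) i with hik | hik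
      · obtain ⟨i, rfl⟩ : ∃ l, i = l + 1 := ⟨i - 1, by omega⟩
        rw [hconst i n (by omega) (by omega)]
        refine (ih i (by omega) (by omega)).trans_eq ?_
        congr 2
        omega
      · rw [Nat.sub_eq_zero_of_le hik, Nat.sub_zero]
        refine le_trans ?_ hbound
        obtain ⟨i, rfl⟩ : ∃ l, i = l + 1 := ⟨i - 1, by omega⟩
        rcases Nat.eq_zero_or_pos i with rfl | hi0
        · exact (hone n hn).trans (le_add_of_nonneg_left (by positivity))
        · refine (hsucc i n hi0 (by omega) hn).trans ?_
          gcongr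
          have := ih i hi0 (by omega)
          rwa [Nat.sub_eq_zero_of_le (by omega : i ≤ k + 1), Nat.sub_zero] at this
  refine ⟨K * ρ ^ (k + 1), ρ, hρ1, fun n => (key _ (by omega) (k + 1) (by omega) (by omega)).trans_eq ?_⟩
  rw [Nat.sub_self, Nat.sub_zero, pow_add, mul_assoc]


/-! ### Boundedness and growth of the operators of the recursion -/

section Bounded

variable {𝕜 X Y Z : Type*} [RCLike 𝕜] [NormedAddCommGroup X] [NormedSpace 𝕜 X]
  [NormedAddCommGroup Y] [NormedSpace 𝕜 Y] [NormedAddCommGroup Z] [NormedSpace 𝕜 Z]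

open Classical in
/-- The bounded operator given by a continuous linear map (and `0` for other linear maps). -/
def toCLM (f : X →ₗ[𝕜] Y) : X →L[𝕜] Y := if h : Continuous f then ⟨f, h⟩ else 0

theorem coe_toCLM {f : X →ₗ[𝕜] Y} (h : Continuous f) : (toCLM f : X →ₗ[𝕜] Y) = f := by
  rw [toCLM, dif_pos h]

theorem toCLM_apply {f : X →ₗ[𝕜] Y} (h : Continuous f) (x : X) : toCLM f x = f x :=
  LinearMap.congr_fun (coe_toCLM h) x

theorem continuous_comp {f : Y →ₗ[𝕜] Z} {g : X →ₗ[𝕜] Y} (hf : Continuous f) (hg : Continuous g) :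
    Continuous (f ∘ₗ g) := hf.comp hg

theorem continuous_sum {ι : Type*} {s : Finset ι} {f : ι → X →ₗ[𝕜] Y}
    (h : ∀ i ∈ s, Continuous (f i)) : Continuous (∑ i ∈ s, f i : X →ₗ[𝕜] Y) := by
  have : ⇑(∑ i ∈ s, f i : X →ₗ[𝕜] Y) = fun x => ∑ i ∈ s, f i x := by
    ext x; exact LinearMap.sum_apply _ _ _
  rw [this]
  exact continuous_finsetSum _ h

theorem continuous_neg' {f : X →ₗ[𝕜] Y} (h : Continuous f) : Continuous (-f) := h.neg

namespace Recursion

/-- Closed graph: let `u → y` and `Tₙu → x`. Continuity of `Pₙ` puts `x` in `Nᶜₙ`, continuity of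
`Sₙ` and `𝒫ₙ` gives `Sₙx = 𝒫ₙy`, and so `x = Tₙ Sₙ x = Tₙ y`. -/
theorem continuous_T [CompleteSpace X] [CompleteSpace Y] {L : ℕ → X →ₗ[𝕜] Y} (D : Recursion L)
    {n : ℕ} (hn : 1 ≤ n) (hP : Continuous (D.P n)) (hQ : Continuous (D.Q n))
    (hS : Continuous (D.S n)) : Continuous (D.T n) := by
  refine LinearMap.continuous_of_seq_closed_graph _ fun u y x hu hT => ?_
  have hPx : D.P n x = x := by
    refine tendsto_nhds_unique ((hP.tendsto x).comp hT) (hT.congr fun m => ?_)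
    simp [D.P_T hn hn]
  have hSx : D.S n x = D.Q n y := by
    refine tendsto_nhds_unique ((hS.tendsto x).comp hT) (((hQ.tendsto y).comp hu).congr fun m => ?_)
    simp [D.S_T hn]
  have hx : x ∈ D.Nc n := hPx ▸ D.P_mem n x
  rw [← D.T_Q hn, ← hSx, D.T_S hn hx]

variable {L : ℕ → X →L[𝕜] Y} (D : Recursion fun i => (L i : X →ₗ[𝕜] Y)) {k : ℕ}
  (hk : StabilizesAt (fun i => (L i : X →ₗ[𝕜] Y)) k)
  (hP : ∀ i ∈ Finset.Icc 1 (k + 1), Continuous (D.P i))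
  (hQ : ∀ i ∈ Finset.Icc 1 (k + 1), Continuous (D.Q i))

include hk hQ in
theorem continuous_Q {n : ℕ} (hn : 1 ≤ n) : Continuous (D.Q n) := by
  rcases Nat.lt_or_ge (k + 1) n with h | h
  · rw [D.Q_eq_zero_of_le hk h]; exact continuous_zero
  · exact hQ n (Finset.mem_Icc.2 ⟨hn, h⟩)

variable [CompleteSpace X] [CompleteSpace Y]
include hk hP hQ

theorem continuous_stage {n : ℕ} (hn : 1 ≤ n) :
    Continuous (D.Sbar n) ∧ Continuous (D.S n) ∧ Continuous (D.T n) ∧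
      (∀ i, 1 ≤ i → i ≤ n → Continuous (D.E i n)) ∧
      ∀ i, 1 ≤ i → i ≤ n → Continuous (D.M i n) := by
  induction n using Nat.strong_induction_on with
  | _ n ih =>
  obtain ⟨n, rfl⟩ : ∃ l, n = l + 1 := ⟨n - 1, by omega⟩
  have hSbar : Continuous (D.Sbar (n + 1)) := by
    rcases Nat.eq_zero_or_pos n with rfl | hn0
    · rw [D.Sbar_one]; exact (L 0).continuous
    · rw [D.Sbar_succ hn0]
      refine continuous_sum fun i hi => continuous_comp (L i).continuous ?_
      have hi := Finset.mem_Icc.1 hi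
      exact (ih n (by omega) hn0).2.2.2.2 i hi.1 hi.2
  have hS : Continuous (D.S (n + 1)) := by
    rw [D.S_succ]
    refine continuous_comp ?_ hSbar
    exact Continuous.sub continuous_id
      (continuous_sum fun i hi => D.continuous_Q hk hQ (Finset.mem_Icc.1 hi).1)
  have hT : Continuous (D.T (n + 1)) := by
    rcases Nat.lt_or_ge (k + 1) (n + 1) with h | h
    · rw [D.T_eq_zero_of_le hk h]; exact continuous_zero
    · have := Finset.mem_Icc.2 ⟨hn, h⟩
      exact D.continuous_T hn (hP _ this) (hQ _ this) hS
  -- `E_{i,n+1}` is built from the rows below it, so the induction runs on the distance `d` to the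
  -- bottom row.
  have hE : ∀ d i, 1 ≤ i → i + d = n + 1 → Continuous (D.E i (n + 1)) := by
    intro d
    induction d using Nat.strong_induction_on with
    | _ d ihd =>
    intro i hi hid
    rcases Nat.eq_zero_or_pos d with rfl | hd
    · obtain rfl : i = n + 1 := by omega
      rw [D.E_self hn]; exact continuous_id
    · rw [D.E_of_lt (by omega)]
      refine continuous_neg' (continuous_comp (ih i (by omega) hi).2.2.1
        (continuous_sum fun v hv => ?_))
      have hv := Finset.mem_Icc.1 hv
      refine continuous_comp ?_ (ihd (n + 1 - v) (by omega) v (by omega) (by omega))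
      rcases Nat.lt_or_ge v (n + 1) with h | h
      · exact (ih v h (by omega)).1
      · obtain rfl : v = n + 1 := by omega
        exact hSbar
  refine ⟨hSbar, hS, hT, fun i hi hin => hE (n + 1 - i) i hi (by omega), fun i hi hin => ?_⟩
  rcases Nat.lt_or_ge 1 i with h | h
  · rw [D.M_of_two_le h hn]
    refine continuous_sum fun j hj => ?_
    have hj := Finset.mem_Icc.1 hj
    exact continuous_comp ((ih (j - 1) (by omega) (by omega)).2.2.2.2 _ (by omega) (by omega))
      (hE (n + 1 - j) j (by omega) (by omega))
  · obtain rfl : i = 1 := by omega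
    rw [D.M_one hn]
    exact hE n 1 le_rfl (by omega)

theorem continuous_S {n : ℕ} (hn : 1 ≤ n) : Continuous (D.S n) :=
  (D.continuous_stage hk hP hQ hn).2.1

theorem continuous_T_of_stabilizes {n : ℕ} (hn : 1 ≤ n) : Continuous (D.T n) :=
  (D.continuous_stage hk hP hQ hn).2.2.1

theorem continuous_M {i n : ℕ} (hi : 1 ≤ i) (hin : i ≤ n) : Continuous (D.M i n) :=
  (D.continuous_stage hk hP hQ (hi.trans hin)).2.2.2.2 i hi hin

theorem continuous_phi (i : ℕ) : Continuous (D.phi k i) :=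
  D.continuous_M hk hP hQ (by omega) (by omega)

theorem continuous_psi (i : ℕ) : Continuous (D.psi k i) := by
  rw [psi]
  split_ifs
  · exact continuous_id
  · refine continuous_sum fun j hj => ?_
    have hj := (Finset.mem_Icc.1 hj).1
    exact continuous_comp (D.continuous_S hk hP hQ (by omega))
      (D.continuous_T_of_stabilizes hk hP hQ hj)

/-- Beyond stage `k + 1`, `E_{i,n}` depends on `n` only through `S̄ₙ`. -/
theorem exists_E_eq {i : ℕ} (hi : 1 ≤ i) (hik : i ≤ k + 1) :
    ∃ G : Y →L[𝕜] X, ∀ n, k + 2 ≤ n → D.E i n = (G : Y →ₗ[𝕜] X) ∘ₗ D.Sbar n := by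
  obtain ⟨d, hd⟩ : ∃ d, i + d = k + 1 := ⟨k + 1 - i, by omega⟩
  induction d using Nat.strong_induction_on generalizing i with
  | _ d ih =>
  have h1 : ∀ v : ℕ, ∃ G : Y →L[𝕜] X, i + 1 ≤ v → v ≤ k + 1 → ∀ n, k + 2 ≤ n →
      D.E v n = (G : Y →ₗ[𝕜] X) ∘ₗ D.Sbar n := fun v => by
    by_cases hv : i + 1 ≤ v ∧ v ≤ k + 1
    · obtain ⟨G, hG⟩ := ih (k + 1 - v) (by omega) (i := v) (by omega) hv.2 (by omega)
      exact ⟨G, fun _ _ => hG⟩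
    · exact ⟨0, fun a b => absurd ⟨a, b⟩ hv⟩
  choose G hG using h1
  -- In the defining sum the rows `k + 2, …, n - 1` vanish and the row `n` is the identity, which
  -- contributes `S̄ₙ`.
  refine ⟨-(toCLM (D.T i) ∘L (∑ v ∈ Finset.Icc (i + 1) (k + 1), toCLM (D.Sbar v) ∘L G v +
    ContinuousLinearMap.id 𝕜 Y)), fun n hn => ?_⟩
  ext x
  have hsum : ∑ v ∈ Finset.Icc (i + 1) n, D.Sbar v (D.E v n x) =
      ∑ v ∈ Finset.Icc (i + 1) (k + 1), D.Sbar v (D.E v n x) + D.Sbar n x := by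
    have hsub : insert n (Finset.Icc (i + 1) (k + 1)) ⊆ Finset.Icc (i + 1) n := fun v hv => by
      simp only [Finset.mem_insert, Finset.mem_Icc] at *; omega
    rw [← Finset.sum_subset hsub, Finset.sum_insert (by simp; omega), D.E_self (by omega), add_comm]
    · rfl
    · intro v hv hv'
      simp only [Finset.mem_insert, Finset.mem_Icc] at *
      rw [D.E_eq_zero_of_le hk (by omega) (by omega)]
      simp
  rw [D.E_of_lt (by omega)]
  simp only [LinearMap.neg_apply, LinearMap.comp_apply, LinearMap.sum_apply, hsum,
    ContinuousLinearMap.coe_coe, neg_apply, ContinuousLinearMap.comp_apply,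
    add_apply, sum_apply, ContinuousLinearMap.id_apply]
  rw [toCLM_apply (D.continuous_T_of_stabilizes hk hP hQ hi)]
  congr 3
  refine Finset.sum_congr rfl fun v hv => ?_
  have hv := Finset.mem_Icc.1 hv
  rw [toCLM_apply (D.continuous_stage hk hP hQ (by omega)).1, hG v hv.1 hv.2 n hn]
  rfl

/-- Only the corrections with `j ≤ k + 1` in `M_succ` survive; there `M_{i,j-1}` is independent of
`n` and `E_{j,n+1}` is a fixed operator applied after `S̄ₙ₊₁`. -/
theorem exists_M_eq {i : ℕ} (hi : 1 ≤ i) :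
    ∃ H : Y →L[𝕜] X, ∀ n, k + 1 ≤ n → i ≤ n →
      D.M (i + 1) (n + 1) = D.M i n + (H : Y →ₗ[𝕜] X) ∘ₗ D.Sbar (n + 1) := by
  have h1 : ∀ v : ℕ, ∃ G : Y →L[𝕜] X, 1 ≤ v → v ≤ k + 1 → ∀ n, k + 2 ≤ n →
      D.E v n = (G : Y →ₗ[𝕜] X) ∘ₗ D.Sbar n := fun v => by
    by_cases hv : 1 ≤ v ∧ v ≤ k + 1
    · obtain ⟨G, hG⟩ := D.exists_E_eq hk hP hQ hv.1 hv.2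
      exact ⟨G, fun _ _ => hG⟩
    · exact ⟨0, fun a b => absurd ⟨a, b⟩ hv⟩
  choose G hG using h1
  refine ⟨∑ j ∈ Finset.Icc (i + 1) (k + 1), toCLM (D.M i (j - 1)) ∘L G j, fun n hn hin => ?_⟩
  ext x
  have hsub : Finset.Icc (i + 1) (k + 1) ⊆ Finset.Icc (i + 1) n := Finset.Icc_subset_Icc_right hn
  rw [D.M_succ hi hin, ← Finset.sum_subset hsub]
  · simp only [LinearMap.add_apply, LinearMap.comp_apply, ContinuousLinearMap.coe_coe,
      sum_apply, ContinuousLinearMap.comp_apply]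
    congr 1
    refine Finset.sum_congr rfl fun j hj => ?_
    have hj := Finset.mem_Icc.1 hj
    rw [toCLM_apply (D.continuous_M hk hP hQ hi (by omega)), hG j (by omega) hj.2 _ (by omega)]
    rfl
  · intro j hj hj'
    simp only [Finset.mem_Icc] at *
    rw [D.E_eq_zero_of_le hk (by omega) (by omega)]
    simp

theorem toCLM_Sbar_succ {n : ℕ} (hn : 1 ≤ n) :
    toCLM (D.Sbar (n + 1)) = ∑ i ∈ Finset.Icc 1 n, L i ∘L toCLM (D.M i n) := by
  ext x
  rw [toCLM_apply (D.continuous_stage hk hP hQ (by omega)).1, D.Sbar_succ hn, LinearMap.sum_apply,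
    sum_apply]
  refine Finset.sum_congr rfl fun i hi => ?_
  have hi := Finset.mem_Icc.1 hi
  rw [ContinuousLinearMap.comp_apply, toCLM_apply (D.continuous_M hk hP hQ hi.1 hi.2)]
  rfl

theorem geomBdd_phi (hL : GeomBdd L) : GeomBdd fun i => toCLM (D.phi k i) := by
  obtain ⟨K₀, r, hr, hLr⟩ := hL
  have hK₀ : 0 ≤ K₀ := by simpa using (norm_nonneg _).trans (hLr 0)
  obtain ⟨G, hG⟩ := D.exists_E_eq hk hP hQ le_rfl (by omega : 1 ≤ k + 1)
  have hH : ∀ i, ∃ H : Y →L[𝕜] X, 1 ≤ i → ∀ n, k + 1 ≤ n → i ≤ n →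
      D.M (i + 1) (n + 1) = D.M i n + (H : Y →ₗ[𝕜] X) ∘ₗ D.Sbar (n + 1) := fun i => by
    by_cases hi : 1 ≤ i
    · obtain ⟨H, h⟩ := D.exists_M_eq hk hP hQ hi
      exact ⟨H, fun _ => h⟩
    · exact ⟨0, fun h => absurd h hi⟩
  choose H hH using hH
  have hsum : 0 ≤ ∑ i ∈ Finset.range (k + 1), ‖H i‖ := Finset.sum_nonneg fun _ _ => norm_nonneg _
  have hSc : ∀ {n : ℕ}, 1 ≤ n → Continuous (D.Sbar n) := fun hn =>
    (D.continuous_stage hk hP hQ hn).1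
  refine exists_geometric_bound (m := fun i n => ‖toCLM (D.M i n)‖)
    (s := fun n => ‖toCLM (D.Sbar n)‖) (k := k) (K₀ := K₀) (r := r)
    -- One constant for all rows: finitely many `H i` suffice, because from row `k + 1` on the
    -- diagonals are constant.
    (h := ‖G‖ + ∑ i ∈ Finset.range (k + 1), ‖H i‖)
    (fun _ _ => norm_nonneg _) hK₀ hr (by positivity) ?_ ?_ ?_ ?_
  · intro n hn
    rw [D.toCLM_Sbar_succ hk hP hQ (by omega)]
    refine norm_sum_le_of_le _ fun i _ => (ContinuousLinearMap.opNorm_comp_le _ _).trans ?_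
    gcongr
    exact hLr i
  · intro n hn
    have e : toCLM (D.M 1 (n + 1)) = G ∘L toCLM (D.Sbar (n + 1)) := by
      ext x
      rw [toCLM_apply (D.continuous_M hk hP hQ le_rfl (by omega)), D.M_one (by omega),
        hG _ (by omega), ContinuousLinearMap.comp_apply, toCLM_apply (hSc (by omega))]
      rfl
    rw [e]
    refine (ContinuousLinearMap.opNorm_comp_le _ _).trans ?_
    gcongr
    linarith
  · intro i n hi hik hn
    have e : toCLM (D.M (i + 1) (n + 1)) = toCLM (D.M i n) + H i ∘L toCLM (D.Sbar (n + 1)) := by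
      ext x
      rw [toCLM_apply (D.continuous_M hk hP hQ (by omega) (by omega)), hH i hi n hn (by omega),
        LinearMap.add_apply, add_apply, ContinuousLinearMap.comp_apply,
        toCLM_apply (hSc (by omega)), toCLM_apply (D.continuous_M hk hP hQ hi (by omega))]
      rfl
    rw [e]
    refine (norm_add_le _ _).trans ?_
    gcongr
    refine (ContinuousLinearMap.opNorm_comp_le _ _).trans ?_
    gcongr
    have := Finset.single_le_sum (f := fun i => ‖H i‖) (fun _ _ => norm_nonneg _)
      (Finset.mem_range.2 (by omega : i < k + 1))
    linarith [norm_nonneg G]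
  · intro i n hi hin
    rw [D.M_succ_of_le hk hi hin]

theorem toCLM_S_succ (n : ℕ) : ∑ i ∈ Finset.range (n + 1), L i ∘L toCLM (D.phi k (n - i)) =
    toCLM (D.S (n + 1)) := by
  ext x
  rw [toCLM_apply (D.continuous_S hk hP hQ (by omega)), ← D.sum_L_comp_phi hk n x,
    sum_apply]
  refine Finset.sum_congr rfl fun i _ => ?_
  rw [ContinuousLinearMap.comp_apply, toCLM_apply (D.continuous_phi hk hP hQ _)]
  rfl

theorem geomBdd_S (hL : GeomBdd L) : GeomBdd fun i => toCLM (D.S (i + 1)) := by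
  have := hL.comp (D.geomBdd_phi hk hP hQ hL)
  simpa only [D.toCLM_S_succ hk hP hQ] using this

theorem geomBdd_psi (hL : GeomBdd L) : GeomBdd fun i => toCLM (D.psi k i) := by
  -- `ψ₀ = I` does not follow the formula for `i ≥ 1`; the shift removes it.
  refine GeomBdd.of_shift (m := 1) ?_
  have e : ∀ n, toCLM (D.psi k (n + 1)) =
      ∑ j ∈ Finset.Icc 1 (k + 1), toCLM (D.S (n + j + 1)) ∘L toCLM (D.T j) := fun n => by
    ext y
    rw [toCLM_apply (D.continuous_psi hk hP hQ _), psi, if_neg (by omega), LinearMap.sum_apply,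
      sum_apply]
    refine Finset.sum_congr rfl fun j hj => ?_
    rw [ContinuousLinearMap.comp_apply, toCLM_apply (D.continuous_S hk hP hQ (by omega)),
      toCLM_apply (D.continuous_T_of_stabilizes hk hP hQ (Finset.mem_Icc.1 hj).1),
      show n + 1 + j = n + j + 1 by omega]
    rfl
  simp only [e]
  exact GeomBdd.sum fun j _ => ((D.geomBdd_S hk hP hQ hL).shift j).comp_const _

end Recursion

end Bounded


open Filter Topology

/-! ### Diagonal families and their generalized inverses -/

section Diagonal

variable {𝕜 X Y : Type*} [RCLike 𝕜] [NormedAddCommGroup X] [NormedSpace 𝕜 X]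
  [NormedAddCommGroup Y] [NormedSpace 𝕜 Y]

theorem sum_Icc_one_succ {M : Type*} [AddCommMonoid M] (f : ℕ → M) (k : ℕ) :
    ∑ i ∈ Finset.Icc 1 (k + 1), f i = ∑ i ∈ Finset.range (k + 1), f (i + 1) := by
  rw [← Finset.Ico_add_one_right_eq_Icc, Finset.sum_Ico_eq_sum_range, Nat.add_sub_cancel]
  exact Finset.sum_congr rfl fun i _ => by rw [add_comm]

/-- The relations between `Sᵢ`, `Tᵢ = Sᵢ⁻¹ 𝒫ᵢ`, `Pᵢ` and `𝒫ᵢ`, for `i = 1, …, k + 1`. -/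
structure DiagonalData (k : ℕ) (S : ℕ → X →L[𝕜] Y) (T : ℕ → Y →L[𝕜] X) (P : ℕ → X →L[𝕜] X)
    (Q : ℕ → Y →L[𝕜] Y) : Prop where
  T_S_P : ∀ i ≤ k, ∀ j ≤ k, ∀ x, T (i + 1) (S (j + 1) (P (j + 1) x)) =
    if i = j then P (j + 1) x else 0
  P_T : ∀ i ≤ k, ∀ j ≤ k, ∀ y, P (i + 1) (T (j + 1) y) = if i = j then T (j + 1) y else 0
  S_T : ∀ i ≤ k, ∀ y, S (i + 1) (T (i + 1) y) = Q (i + 1) y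

theorem Delta_apply (k : ℕ) (S : ℕ → X →L[𝕜] Y) (P : ℕ → X →L[𝕜] X) (ε : 𝕜) (x : X) :
    Delta k S P ε x = ∑ i ∈ Finset.range (k + 1), ε ^ i • S (i + 1) (P (i + 1) x) := by
  simp [Delta]

theorem DeltaInv_apply (k : ℕ) (T : ℕ → Y →L[𝕜] X) (ε : 𝕜) (y : Y) :
    DeltaInv k T ε y = ∑ i ∈ Finset.range (k + 1), (ε ^ i)⁻¹ • T (i + 1) y := by
  simp [DeltaInv]

namespace DiagonalData

variable {k : ℕ} {S : ℕ → X →L[𝕜] Y} {T : ℕ → Y →L[𝕜] X} {P : ℕ → X →L[𝕜] X}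
  {Q : ℕ → Y →L[𝕜] Y} (h : DiagonalData k S T P Q)
include h

theorem T_Delta {i : ℕ} (hi : i ≤ k) (ε : 𝕜) (x : X) :
    T (i + 1) (Delta k S P ε x) = ε ^ i • P (i + 1) x := by
  rw [Delta_apply, map_sum, Finset.sum_eq_single_of_mem i (Finset.mem_range.2 (by omega))]
  · rw [map_smul, h.T_S_P i hi i hi, if_pos rfl]
  · intro j hj hji
    rw [map_smul, h.T_S_P i hi j (by have := Finset.mem_range.1 hj; omega), if_neg hji.symm,
      smul_zero]

theorem P_DeltaInv {i : ℕ} (hi : i ≤ k) (ε : 𝕜) (y : Y) :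
    P (i + 1) (DeltaInv k T ε y) = (ε ^ i)⁻¹ • T (i + 1) y := by
  rw [DeltaInv_apply, map_sum, Finset.sum_eq_single_of_mem i (Finset.mem_range.2 (by omega))]
  · rw [map_smul, h.P_T i hi i hi, if_pos rfl]
  · intro j hj hji
    rw [map_smul, h.P_T i hi j (by have := Finset.mem_range.1 hj; omega), if_neg hji.symm,
      smul_zero]

variable {ε : 𝕜} (hε : ε ≠ 0)
include hε

theorem DeltaInv_comp_Delta :
    DeltaInv k T ε ∘L Delta k S P ε = ∑ i ∈ Finset.Icc 1 (k + 1), P i := by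
  ext x
  rw [sum_Icc_one_succ, ContinuousLinearMap.comp_apply, DeltaInv_apply, sum_apply]
  refine Finset.sum_congr rfl fun i hi => ?_
  rw [h.T_Delta (by have := Finset.mem_range.1 hi; omega), inv_smul_smul₀ (pow_ne_zero _ hε)]

theorem Delta_comp_DeltaInv :
    Delta k S P ε ∘L DeltaInv k T ε = ∑ i ∈ Finset.Icc 1 (k + 1), Q i := by
  ext y
  rw [sum_Icc_one_succ, ContinuousLinearMap.comp_apply, Delta_apply, sum_apply]
  refine Finset.sum_congr rfl fun i hi => ?_
  have hi : i ≤ k := by have := Finset.mem_range.1 hi; omega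
  rw [h.P_DeltaInv hi, map_smul, h.S_T i hi, smul_inv_smul₀ (pow_ne_zero _ hε)]

theorem isGenInverse : IsGenInverse (Delta k S P ε) (DeltaInv k T ε) := by
  constructor
  · ext x
    refine (Delta_apply k S P ε (DeltaInv k T ε (Delta k S P ε x))).trans
      (Eq.trans ?_ (Delta_apply k S P ε x).symm)
    refine Finset.sum_congr rfl fun i hi => ?_
    have hi : i ≤ k := by have := Finset.mem_range.1 hi; omega
    rw [h.P_DeltaInv hi, h.T_Delta hi, inv_smul_smul₀ (pow_ne_zero _ hε)]
  · ext y
    refine (DeltaInv_apply k T ε (Delta k S P ε (DeltaInv k T ε y))).trans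
      (Eq.trans ?_ (DeltaInv_apply k T ε y).symm)
    refine Finset.sum_congr rfl fun i hi => ?_
    have hi : i ≤ k := by have := Finset.mem_range.1 hi; omega
    rw [h.T_Delta hi, h.P_DeltaInv hi, smul_inv_smul₀ (pow_ne_zero _ hε)]

theorem Delta_eq_zero_iff {x : X} :
    Delta k S P ε x = 0 ↔ ∀ i ∈ Finset.Icc 1 (k + 1), P i x = 0 := by
  constructor
  · intro h0 i hi
    obtain ⟨i, rfl⟩ : ∃ l, i = l + 1 := ⟨i - 1, by have := Finset.mem_Icc.1 hi; omega⟩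
    have := h.T_Delta (by have := Finset.mem_Icc.1 hi; omega : i ≤ k) ε x
    rw [h0, map_zero, eq_comm, smul_eq_zero] at this
    exact this.resolve_left (pow_ne_zero _ hε)
  · intro h0
    rw [Delta_apply]
    refine Finset.sum_eq_zero fun i hi => ?_
    have := Finset.mem_range.1 hi
    rw [h0 (i + 1) (Finset.mem_Icc.2 ⟨by omega, by omega⟩), map_zero, smul_zero]

theorem range_Delta : LinearMap.range (Delta k S P ε : X →ₗ[𝕜] Y) =
    LinearMap.range (∑ i ∈ Finset.Icc 1 (k + 1), Q i : Y →L[𝕜] Y).toLinearMap := by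
  refine le_antisymm ?_ ?_
  · rintro _ ⟨x, rfl⟩
    refine ⟨Delta k S P ε x, ?_⟩
    rw [← h.Delta_comp_DeltaInv hε]
    exact DFunLike.congr_fun (h.isGenInverse hε).1 x
  · rintro _ ⟨y, rfl⟩
    rw [← h.Delta_comp_DeltaInv hε]
    exact ⟨DeltaInv k T ε y, rfl⟩

end DiagonalData

/-- `εᵏ Δ⁻¹(ε)`, as a polynomial in `ε`. -/
theorem exists_analytic_DeltaInv (k : ℕ) (T : ℕ → Y →L[𝕜] X) :
    ∃ g : 𝕜 → Y →L[𝕜] X, (∀ ε, AnalyticAt 𝕜 g ε) ∧ g 0 = T (k + 1) ∧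
      ∀ ε ≠ 0, DeltaInv k T ε = ε ^ (-(k : ℤ)) • g ε := by
  refine ⟨fun ε => ∑ i ∈ Finset.range (k + 1), ε ^ (k - i) • T (i + 1), fun ε => ?_, ?_, ?_⟩
  · exact Finset.analyticAt_fun_sum _ fun i _ => (analyticAt_id.fun_pow _).smul analyticAt_const
  · dsimp only
    rw [Finset.sum_eq_single_of_mem k (by simp)]
    · simp
    · intro i hi hik
      have := Finset.mem_range.1 hi
      rw [zero_pow (by omega), zero_smul]
  · intro ε hε
    rw [DeltaInv, Finset.smul_sum]
    refine Finset.sum_congr rfl fun i hi => ?_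
    have := Finset.mem_range.1 hi
    rw [smul_smul, zpow_neg, zpow_natCast]
    congr 1
    rw [eq_comm, inv_mul_eq_iff_eq_mul₀ (pow_ne_zero _ hε), eq_mul_inv_iff_mul_eq₀ (pow_ne_zero _ hε),
      ← pow_add, Nat.sub_add_cancel (by omega)]

theorem hasPole_of_eq {E : Type*} [NormedAddCommGroup E] [NormedSpace 𝕜 E] {f g : 𝕜 → E} {k : ℕ}
    (hg : AnalyticAt 𝕜 g 0) (hg0 : g 0 ≠ 0)
    (h : ∀ᶠ ε in 𝓝[≠] (0 : 𝕜), f ε = ε ^ (-(k : ℤ)) • g ε) : HasPole f k := by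
  have hf : MeromorphicAt f 0 :=
    (((MeromorphicAt.id 0).zpow (-(k : ℤ))).smul hg.meromorphicAt).congr
      (h.mono fun ε hε => hε.symm)
  exact ⟨hf, (meromorphicOrderAt_eq_int_iff hf).2 ⟨g, hg, hg0, by simpa using h⟩⟩

theorem analyticAt_clm_comp {Z : Type*} [NormedAddCommGroup Z] [NormedSpace 𝕜 Z]
    {f : 𝕜 → Y →L[𝕜] Z} {g : 𝕜 → X →L[𝕜] Y} {ε : 𝕜} (hf : AnalyticAt 𝕜 f ε)
    (hg : AnalyticAt 𝕜 g ε) : AnalyticAt 𝕜 (fun ε => f ε ∘L g ε) ε :=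
  AnalyticAt.comp₂ (h := fun p : (Y →L[𝕜] Z) × (X →L[𝕜] Y) => p.1 ∘L p.2)
    ((ContinuousLinearMap.compL 𝕜 X Y Z).analyticAt_bilinear _) hf hg

/-- `Δ(ε)` is written as a full power series so that the Cauchy product with `ψ(ε)` applies. -/
theorem hasSum_Delta (k : ℕ) (S : ℕ → X →L[𝕜] Y) (P : ℕ → X →L[𝕜] X) (ε : 𝕜) :
    HasSum (fun i : ℕ => ε ^ i • if i ≤ k then S (i + 1) ∘L P (i + 1) else 0) (Delta k S P ε) ∧
    Summable fun i : ℕ => ‖ε ^ i • if i ≤ k then S (i + 1) ∘L P (i + 1) else 0‖ := by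
  have h0 : ∀ i ∉ Finset.range (k + 1),
      (ε ^ i • if i ≤ k then S (i + 1) ∘L P (i + 1) else 0) = 0 := fun i hi => by
    rw [if_neg (by simpa [Nat.lt_succ_iff] using hi), smul_zero]
  constructor
  · convert hasSum_sum_of_ne_finset_zero (L := .unconditional ℕ) h0 using 1
    refine Finset.sum_congr rfl fun i hi => ?_
    rw [if_pos (by simpa [Nat.lt_succ_iff] using hi)]
  · exact summable_of_ne_finset_zero (s := Finset.range (k + 1)) fun i hi => by
      rw [h0 i hi, norm_zero]

/-- Conjugation of an idempotent by an invertible operator. -/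
theorem isIdempotentElem_conj {A A' p : X →L[𝕜] X} (h : A' ∘L A = ContinuousLinearMap.id 𝕜 X)
    (hp : ∀ x, p (p x) = p x) : IsIdempotentElem (A ∘L p ∘L A') := by
  ext x
  have h' : ∀ x, A' (A x) = x := DFunLike.congr_fun h
  simp [h', hp]

theorem range_conj {A A' p : X →L[𝕜] X} (h : A' ∘L A = ContinuousLinearMap.id 𝕜 X) :
    LinearMap.range (A ∘L p ∘L A' : X →L[𝕜] X).toLinearMap =
      (LinearMap.range p.toLinearMap).map (A : X →ₗ[𝕜] X) := by
  have h' : ∀ x, A' (A x) = x := DFunLike.congr_fun h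
  ext y
  constructor
  · rintro ⟨x, rfl⟩
    exact ⟨p (A' x), ⟨A' x, rfl⟩, rfl⟩
  · rintro ⟨_, ⟨x, rfl⟩, rfl⟩
    exact ⟨A x, by simp [h']⟩

end Diagonal

namespace IsSplitting

theorem range_sum_splitProj {𝕜 X : Type*} [Field 𝕜] [AddCommGroup X] [Module 𝕜 X]
    {A Z : ℕ → Submodule 𝕜 X} (h : IsSplitting A Z) (n : ℕ) :
    LinearMap.range (∑ i ∈ Finset.Icc 1 n, splitProj A Z i) = ⨆ i ∈ Finset.Icc 1 n, A i := by
  refine le_antisymm ?_ fun x hx => ⟨x, ?_⟩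
  · rintro _ ⟨x, rfl⟩
    rw [LinearMap.sum_apply]
    exact sum_splitProj_mem A Z n x
  · rw [LinearMap.sum_apply, h.sum_splitProj_of_mem hx]

end IsSplitting

end OperatorDiag

end

/-! ### The diagonalization theorem -/

theorem theorem3 {𝕜 B C : Type*} [RCLike 𝕜]
    [NormedAddCommGroup B] [NormedSpace 𝕜 B] [CompleteSpace B]
    [NormedAddCommGroup C] [NormedSpace 𝕜 C] [CompleteSpace C]
    -- the analytic family `F(ε) = ∑ εⁱ Lᵢ`
    (U : Set 𝕜) (hU : IsOpen U) (hU0 : (0 : 𝕜) ∈ U)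
    (F : 𝕜 → B →L[𝕜] C) (hF : AnalyticOnNhd 𝕜 F U)
    (L : ℕ → B →L[𝕜] C)
    (hL : ∀ᶠ ε in nhds (0 : 𝕜), HasSum (fun i : ℕ => ε ^ i • L i) (F ε))
    -- stabilization at level `k`, and any run of the recursion
    (k : ℕ) (hk : OperatorDiag.StabilizesAt (fun i => (L i : B →ₗ[𝕜] C)) k)
    (D : OperatorDiag.Recursion (fun i => (L i : B →ₗ[𝕜] C)))
    -- the projections to `Nᶜᵢ` and `Rᵢ` are continuous for `i = 1, …, k + 1`
    (P : ℕ → B →L[𝕜] B) (hP : ∀ i ∈ Finset.Icc 1 (k + 1), (P i : B →ₗ[𝕜] B) = D.P i)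
    (Q : ℕ → C →L[𝕜] C) (hQ : ∀ i ∈ Finset.Icc 1 (k + 1), (Q i : C →ₗ[𝕜] C) = D.Q i) :
    -- the operators of the recursion are bounded
    ∃ (S : ℕ → B →L[𝕜] C) (T : ℕ → C →L[𝕜] B)
      (φc : ℕ → B →L[𝕜] B) (ψc : ℕ → C →L[𝕜] C),
      (∀ i, 1 ≤ i → (S i : B →ₗ[𝕜] C) = D.S i) ∧
      (∀ i ∈ Finset.Icc 1 (k + 1), (T i : C →ₗ[𝕜] B) = D.T i) ∧
      (∀ i, (φc i : B →ₗ[𝕜] B) = D.phi k i) ∧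
      (∀ i, (ψc i : C →ₗ[𝕜] C) = D.psi k i) ∧
    -- the analytic near identity transformations and their inverses
    ∃ (V : Set 𝕜) (φ φi : 𝕜 → B →L[𝕜] B) (ψ ψi : 𝕜 → C →L[𝕜] C),
      IsOpen V ∧ (0 : 𝕜) ∈ V ∧ V ⊆ U ∧
      AnalyticOnNhd 𝕜 φ V ∧ AnalyticOnNhd 𝕜 φi V ∧
      AnalyticOnNhd 𝕜 ψ V ∧ AnalyticOnNhd 𝕜 ψi V ∧
      φ 0 = ContinuousLinearMap.id 𝕜 B ∧ ψ 0 = ContinuousLinearMap.id 𝕜 C ∧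
      (∀ ε ∈ V,
        HasSum (fun i : ℕ => ε ^ i • φc i) (φ ε) ∧
        HasSum (fun i : ℕ => ε ^ i • ψc i) (ψ ε) ∧
        φ ε ∘L φi ε = ContinuousLinearMap.id 𝕜 B ∧
        φi ε ∘L φ ε = ContinuousLinearMap.id 𝕜 B ∧
        ψ ε ∘L ψi ε = ContinuousLinearMap.id 𝕜 C ∧
        ψi ε ∘L ψ ε = ContinuousLinearMap.id 𝕜 C) ∧
      -- (i) the analytic normal form `S(ε) = L(ε) φ(ε)`
      AnalyticOnNhd 𝕜 (fun ε => F ε ∘L φ ε) V ∧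
      (∀ ε ∈ V, HasSum (fun i : ℕ => ε ^ i • S (i + 1)) (F ε ∘L φ ε)) ∧
      (∀ i ∈ Finset.Icc 1 (k + 1),
        (⨆ j ∈ Finset.range i, D.Nc j).map (D.S i) ≤ D.Rc (i - 1) ∧
        (D.Nc i).map (D.S i) = D.R i ∧
        D.N i ≤ LinearMap.ker (D.S i)) ∧
      (∀ l, 2 ≤ l → LinearMap.range (D.S (k + l)) ≤ D.Rc (k + 1) ∧
        D.N (k + 1) ≤ LinearMap.ker (D.S (k + l))) ∧
      (∀ i, 1 ≤ i → D.N (k + 1) ≤ LinearMap.ker (D.S i)) ∧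
      -- (ii) diagonalization
      (∀ ε ∈ V, ψi ε ∘L F ε ∘L φ ε = OperatorDiag.Delta k S P ε) ∧
      -- (iii) kernels and ranges
      (∀ ε ∈ V \ {0},
        LinearMap.ker (F ε : B →ₗ[𝕜] C) = (D.N (k + 1)).map (φ ε : B →ₗ[𝕜] B) ∧
        LinearMap.range (F ε : B →ₗ[𝕜] C) =
          (⨆ i ∈ Finset.Icc 1 (k + 1), D.R i).map (ψ ε : C →ₗ[𝕜] C)) ∧
      -- (iv) generalized inverses of `Δ(ε)` and of `L(ε)`
      (∀ ε : 𝕜, ε ≠ 0 →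
        OperatorDiag.IsGenInverse (OperatorDiag.Delta k S P ε) (OperatorDiag.DeltaInv k T ε)) ∧
      AnalyticOnNhd 𝕜 (OperatorDiag.DeltaInv k T) {0}ᶜ ∧
      OperatorDiag.HasPole (OperatorDiag.DeltaInv k T) k ∧
      (∀ ε ∈ V \ {0},
        OperatorDiag.IsGenInverse (F ε) (φ ε ∘L OperatorDiag.DeltaInv k T ε ∘L ψi ε)) ∧
      AnalyticOnNhd 𝕜 (fun ε => φ ε ∘L OperatorDiag.DeltaInv k T ε ∘L ψi ε) (V \ {0}) ∧
      OperatorDiag.HasPole (fun ε => φ ε ∘L OperatorDiag.DeltaInv k T ε ∘L ψi ε) k ∧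
      -- the associated projections, their ranges, and their continuation to `ε = 0`
      (∀ ε ∈ V \ {0},
        (φ ε ∘L OperatorDiag.DeltaInv k T ε ∘L ψi ε) ∘L F ε =
          φ ε ∘L (∑ i ∈ Finset.Icc 1 (k + 1), P i) ∘L φi ε ∧
        F ε ∘L (φ ε ∘L OperatorDiag.DeltaInv k T ε ∘L ψi ε) =
          ψ ε ∘L (∑ i ∈ Finset.Icc 1 (k + 1), Q i) ∘L ψi ε) ∧
      (∀ ε ∈ V,
        IsIdempotentElem (φ ε ∘L (∑ i ∈ Finset.Icc 1 (k + 1), P i) ∘L φi ε) ∧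
        LinearMap.range (φ ε ∘L (∑ i ∈ Finset.Icc 1 (k + 1), P i) ∘L φi ε : B →ₗ[𝕜] B) =
          (⨆ i ∈ Finset.Icc 1 (k + 1), D.Nc i).map (φ ε : B →ₗ[𝕜] B) ∧
        IsIdempotentElem (ψ ε ∘L (∑ i ∈ Finset.Icc 1 (k + 1), Q i) ∘L ψi ε) ∧
        LinearMap.range (ψ ε ∘L (∑ i ∈ Finset.Icc 1 (k + 1), Q i) ∘L ψi ε : C →ₗ[𝕜] C) =
          (⨆ i ∈ Finset.Icc 1 (k + 1), D.R i).map (ψ ε : C →ₗ[𝕜] C)) ∧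
      AnalyticOnNhd 𝕜 (fun ε => φ ε ∘L (∑ i ∈ Finset.Icc 1 (k + 1), P i) ∘L φi ε) V ∧
      AnalyticOnNhd 𝕜 (fun ε => ψ ε ∘L (∑ i ∈ Finset.Icc 1 (k + 1), Q i) ∘L ψi ε) V ∧
      φ 0 ∘L (∑ i ∈ Finset.Icc 1 (k + 1), P i) ∘L φi 0 = ∑ i ∈ Finset.Icc 1 (k + 1), P i ∧
      ψ 0 ∘L (∑ i ∈ Finset.Icc 1 (k + 1), Q i) ∘L ψi 0 =
        ∑ i ∈ Finset.Icc 1 (k + 1), Q i := by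
  have hPx : ∀ i ∈ Finset.Icc 1 (k + 1), ∀ x, P i x = D.P i x := fun i hi x =>
    LinearMap.congr_fun (hP i hi) x
  have hQx : ∀ i ∈ Finset.Icc 1 (k + 1), ∀ y, Q i y = D.Q i y := fun i hi y =>
    LinearMap.congr_fun (hQ i hi) y
  have hPc : ∀ i ∈ Finset.Icc 1 (k + 1), Continuous (D.P i) := fun i hi => by
    rw [← hP i hi]; exact (P i).continuous
  have hQc : ∀ i ∈ Finset.Icc 1 (k + 1), Continuous (D.Q i) := fun i hi => by
    rw [← hQ i hi]; exact (Q i).continuous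
  have hLg : OperatorDiag.GeomBdd L := OperatorDiag.GeomBdd.of_hasSum hL
  have hSx : ∀ i, 1 ≤ i → ∀ x, OperatorDiag.toCLM (D.S i) x = D.S i x := fun i hi =>
    OperatorDiag.toCLM_apply (D.continuous_S hk hPc hQc hi)
  have hTx : ∀ i, 1 ≤ i → ∀ y, OperatorDiag.toCLM (D.T i) y = D.T i y := fun i hi =>
    OperatorDiag.toCLM_apply (D.continuous_T_of_stabilizes hk hPc hQc hi)
  refine ⟨fun i => OperatorDiag.toCLM (D.S i), fun i => OperatorDiag.toCLM (D.T i),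
    fun i => OperatorDiag.toCLM (D.phi k i), fun i => OperatorDiag.toCLM (D.psi k i),
    fun i hi => OperatorDiag.coe_toCLM (D.continuous_S hk hPc hQc hi),
    fun i hi => OperatorDiag.coe_toCLM
      (D.continuous_T_of_stabilizes hk hPc hQc (Finset.mem_Icc.1 hi).1),
    fun i => OperatorDiag.coe_toCLM (D.continuous_phi hk hPc hQc i),
    fun i => OperatorDiag.coe_toCLM (D.continuous_psi hk hPc hQc i), ?_⟩
  set S : ℕ → B →L[𝕜] C := fun i => OperatorDiag.toCLM (D.S i)
  set T : ℕ → C →L[𝕜] B := fun i => OperatorDiag.toCLM (D.T i)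
  have hφg := D.geomBdd_phi hk hPc hQc hLg
  have hψg := D.geomBdd_psi hk hPc hQc hLg
  have hmem : ∀ {i : ℕ}, i ≤ k → i + 1 ∈ Finset.Icc 1 (k + 1) := fun hi =>
    Finset.mem_Icc.2 ⟨by omega, by omega⟩
  have hdiag : OperatorDiag.DiagonalData k S T P Q := by
    refine ⟨fun i hi j hj x => ?_, fun i hi j hj y => ?_, fun i hi y => ?_⟩
    · rw [hPx _ (hmem hj), hSx _ (by omega), hTx _ (by omega),
        D.T_S_of_mem (by omega) (by omega) (D.P_mem _ _)]
      simp
    · rw [hTx _ (by omega), hPx _ (hmem hi), D.P_T (by omega) (by omega)]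
      simp
    · rw [hTx _ (by omega), hSx _ (by omega), hQx _ (hmem hi), D.S_T (by omega)]
  have hPsum : (∑ i ∈ Finset.Icc 1 (k + 1), P i : B →L[𝕜] B).toLinearMap =
      ∑ i ∈ Finset.Icc 1 (k + 1), OperatorDiag.splitProj D.Nc D.N i := by
    ext x
    rw [ContinuousLinearMap.coe_coe, sum_apply, LinearMap.sum_apply]
    exact Finset.sum_congr rfl fun i hi => hPx i hi x
  have hQsum : (∑ i ∈ Finset.Icc 1 (k + 1), Q i : C →L[𝕜] C).toLinearMap =
      ∑ i ∈ Finset.Icc 1 (k + 1), OperatorDiag.splitProj D.R D.Rc i := by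
    ext y
    rw [ContinuousLinearMap.coe_coe, sum_apply, LinearMap.sum_apply]
    exact Finset.sum_congr rfl fun i hi => by rw [hQx i hi, D.Q_eq (Finset.mem_Icc.1 hi).1]
  have hPrange : LinearMap.range (∑ i ∈ Finset.Icc 1 (k + 1), P i : B →L[𝕜] B).toLinearMap =
      ⨆ i ∈ Finset.Icc 1 (k + 1), D.Nc i := by
    rw [hPsum, D.isSplitting_N.range_sum_splitProj]
  have hQrange : LinearMap.range (∑ i ∈ Finset.Icc 1 (k + 1), Q i : C →L[𝕜] C).toLinearMap =
      ⨆ i ∈ Finset.Icc 1 (k + 1), D.R i := by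
    rw [hQsum, D.isSplitting_R.range_sum_splitProj]
  have hPidem : ∀ x, (∑ i ∈ Finset.Icc 1 (k + 1), P i) ((∑ i ∈ Finset.Icc 1 (k + 1), P i) x) =
      (∑ i ∈ Finset.Icc 1 (k + 1), P i) x := fun x => by
    have h1 := D.isSplitting_N.sum_splitProj_of_mem
      (OperatorDiag.sum_splitProj_mem D.Nc D.N (k + 1) x)
    simp only [← LinearMap.sum_apply, ← hPsum] at h1
    exact h1
  have hQidem : ∀ y, (∑ i ∈ Finset.Icc 1 (k + 1), Q i) ((∑ i ∈ Finset.Icc 1 (k + 1), Q i) y) =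
      (∑ i ∈ Finset.Icc 1 (k + 1), Q i) y := fun y => by
    have h1 := D.isSplitting_R.sum_splitProj_of_mem
      (OperatorDiag.sum_splitProj_mem D.R D.Rc (k + 1) y)
    simp only [← LinearMap.sum_apply, ← hQsum] at h1
    exact h1
  have hkerDelta : ∀ ε : 𝕜, ε ≠ 0 → ∀ x, OperatorDiag.Delta k S P ε x = 0 ↔ x ∈ D.N (k + 1) := by
    intro ε hε x
    rw [hdiag.Delta_eq_zero_iff hε]
    refine ⟨fun h0 => D.isSplitting_N.mem_of_splitProj_eq_zero fun i hi => ?_, fun hx i hi => ?_⟩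
    · rw [← D.P_eq, ← hPx i hi, h0 i hi]
    · have hi' := Finset.mem_Icc.1 hi
      rw [hPx i hi]
      exact D.isSplitting_N.splitProj_of_mem_rem hi'.1 hi'.2 hx
  obtain ⟨φ, hφa, hφ0, hφs⟩ := hφg.exists_analyticAt (𝕜 := 𝕜)
  obtain ⟨ψ, hψa, hψ0, hψs⟩ := hψg.exists_analyticAt (𝕜 := 𝕜)
  have hφ1 : φ 0 = ContinuousLinearMap.id 𝕜 B := by
    rw [hφ0]
    ext x
    rw [OperatorDiag.toCLM_apply (D.continuous_phi hk hPc hQc 0)]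
    exact LinearMap.congr_fun (D.M_self (by omega)) x
  have hψ1 : ψ 0 = ContinuousLinearMap.id 𝕜 C := by
    rw [hψ0]
    ext x
    rw [OperatorDiag.toCLM_apply (D.continuous_psi hk hPc hQc 0)]
    rfl
  have hφu : ∀ᶠ ε in nhds (0 : 𝕜), IsUnit (φ ε) :=
    hφa.continuousAt.eventually (Units.isOpen.mem_nhds (by
      rw [Set.mem_ofPred_eq, hφ1]; exact isUnit_one))
  have hψu : ∀ᶠ ε in nhds (0 : 𝕜), IsUnit (ψ ε) :=
    hψa.continuousAt.eventually (Units.isOpen.mem_nhds (by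
      rw [Set.mem_ofPred_eq, hψ1]; exact isUnit_one))
  have hUe : ∀ᶠ ε in nhds (0 : 𝕜), ε ∈ U := hU.mem_nhds hU0
  -- Each requirement on `V` holds near `0`, so one open set serves for all of them.
  obtain ⟨V, hV, hVo, hV0⟩ := eventually_nhds_iff.1 (hUe.and
    (hφa.eventually_analyticAt.and (hψa.eventually_analyticAt.and (hφu.and (hψu.and
    (hL.and (hφs.and (hψs.and (hLg.eventually_summable_norm.and
    (hφg.eventually_summable_norm.and hψg.eventually_summable_norm))))))))))
  have hLφ : ∀ ε ∈ V, HasSum (fun i : ℕ => ε ^ i • S (i + 1)) (F ε ∘L φ ε) := fun ε hε => by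
    obtain ⟨-, -, -, -, -, h1, h2, -, h3, h4, -⟩ := hV ε hε
    have := OperatorDiag.hasSum_smul_comp_range h1 h2 h3 h4
    simpa only [D.toCLM_S_succ hk hPc hQc] using this
  -- Both sides are sums of the same power series.
  have hψΔ : ∀ ε ∈ V, F ε ∘L φ ε = ψ ε ∘L OperatorDiag.Delta k S P ε := fun ε hε => by
    obtain ⟨-, -, -, -, -, -, -, h1, -, -, h3⟩ := hV ε hε
    obtain ⟨h2, h4⟩ := OperatorDiag.hasSum_Delta k S P ε
    have h5 := OperatorDiag.hasSum_smul_comp_range h1 h2 h3 h4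
    refine (hLφ ε hε).unique ?_
    convert h5 using 3 with n
    ext x
    -- The Cauchy product indexes by the order in `ψ`, the algebraic identity by the order in `Δ`;
    -- reversing the sum matches them.
    rw [hSx _ (by omega), ← D.sum_psi_S_P hk n x, sum_apply, ← Finset.sum_flip]
    refine Finset.sum_congr rfl fun i hi => ?_
    have hi := Finset.mem_range.1 hi
    rw [Nat.sub_sub_self (by omega), ContinuousLinearMap.comp_apply,
      OperatorDiag.toCLM_apply (D.continuous_psi hk hPc hQc _)]
    congr 1
    split_ifs with h
    · rw [ContinuousLinearMap.comp_apply, hSx _ (by omega), hPx _ (hmem h)]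
    · rfl
  -- `Ring.inverse` is total; on `V` it is the true inverse because `φ ε` and `ψ ε` are units there.
  have hφφ : ∀ ε ∈ V, φ ε ∘L Ring.inverse (φ ε) = ContinuousLinearMap.id 𝕜 B := fun ε hε =>
    Ring.mul_inverse_cancel _ (hV ε hε).2.2.2.1
  have hφφ' : ∀ ε ∈ V, Ring.inverse (φ ε) ∘L φ ε = ContinuousLinearMap.id 𝕜 B := fun ε hε =>
    Ring.inverse_mul_cancel _ (hV ε hε).2.2.2.1
  have hψψ : ∀ ε ∈ V, ψ ε ∘L Ring.inverse (ψ ε) = ContinuousLinearMap.id 𝕜 C := fun ε hε =>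
    Ring.mul_inverse_cancel _ (hV ε hε).2.2.2.2.1
  have hψψ' : ∀ ε ∈ V, Ring.inverse (ψ ε) ∘L ψ ε = ContinuousLinearMap.id 𝕜 C := fun ε hε =>
    Ring.inverse_mul_cancel _ (hV ε hε).2.2.2.2.1
  have aφ : AnalyticOnNhd 𝕜 φ V := fun ε hε => (hV ε hε).2.1
  have aψ : AnalyticOnNhd 𝕜 ψ V := fun ε hε => (hV ε hε).2.2.1
  have aφi : AnalyticOnNhd 𝕜 (fun ε => Ring.inverse (φ ε)) V := fun ε hε =>
    (analyticOnNhd_inverse (𝕜 := 𝕜) (φ ε) (hV ε hε).2.2.2.1).comp (aφ ε hε)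
  have aψi : AnalyticOnNhd 𝕜 (fun ε => Ring.inverse (ψ ε)) V := fun ε hε =>
    (analyticOnNhd_inverse (𝕜 := 𝕜) (ψ ε) (hV ε hε).2.2.2.2.1).comp (aψ ε hε)
  have hφi0 : Ring.inverse (φ 0) = ContinuousLinearMap.id 𝕜 B := by
    rw [hφ1]; exact Ring.inverse_one _
  have hψi0 : Ring.inverse (ψ 0) = ContinuousLinearMap.id 𝕜 C := by
    rw [hψ1]; exact Ring.inverse_one _
  have hFeq : ∀ ε ∈ V, F ε =
      ψ ε ∘L OperatorDiag.Delta k S P ε ∘L Ring.inverse (φ ε) := fun ε hε => by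
    rw [← ContinuousLinearMap.comp_assoc, ← hψΔ ε hε, ContinuousLinearMap.comp_assoc, hφφ ε hε,
      ContinuousLinearMap.comp_id]
  have hTk : T (k + 1) ≠ 0 := fun h => D.T_ne_zero hk <| by
    rw [← OperatorDiag.coe_toCLM (D.continuous_T_of_stabilizes hk hPc hQc (n := k + 1) (by omega))]
    exact congrArg ContinuousLinearMap.toLinearMap h
  obtain ⟨g, hga, hg0, hg⟩ := OperatorDiag.exists_analytic_DeltaInv k T
  have hpow : ∀ ε : 𝕜, ε ≠ 0 → AnalyticAt 𝕜 (fun ε : 𝕜 => ε ^ (-(k : ℤ))) ε := fun ε hε =>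
    analyticAt_id.fun_zpow hε
  have aΔi : AnalyticOnNhd 𝕜 (OperatorDiag.DeltaInv k T) {0}ᶜ := fun ε hε =>
    ((hpow ε hε).smul (hga ε)).congr <| by
      filter_upwards [isOpen_compl_singleton.mem_nhds hε] with z hz using (hg z hz).symm
  have hφ'x : ∀ ε ∈ V, ∀ x, Ring.inverse (φ ε) (φ ε x) = x := fun ε hε =>
    DFunLike.congr_fun (hφφ' ε hε)
  have hψ'x : ∀ ε ∈ V, ∀ x, Ring.inverse (ψ ε) (ψ ε x) = x := fun ε hε =>
    DFunLike.congr_fun (hψψ' ε hε)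
  have hφx : ∀ ε ∈ V, ∀ x, φ ε (Ring.inverse (φ ε) x) = x := fun ε hε =>
    DFunLike.congr_fun (hφφ ε hε)
  have hFx : ∀ ε ∈ V, ∀ x, F ε x = ψ ε (OperatorDiag.Delta k S P ε (Ring.inverse (φ ε) x)) :=
    fun ε hε => DFunLike.congr_fun (hFeq ε hε)
  refine ⟨V, φ, fun ε => Ring.inverse (φ ε), ψ, fun ε => Ring.inverse (ψ ε), hVo, hV0,
    fun ε hε => (hV ε hε).1, aφ, aφi, aψ, aψi, hφ1, hψ1, fun ε hε => ⟨(hV ε hε).2.2.2.2.2.2.1,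
    (hV ε hε).2.2.2.2.2.2.2.1, hφφ ε hε, hφφ' ε hε, hψψ ε hε, hψψ' ε hε⟩,
    fun ε hε => OperatorDiag.analyticAt_clm_comp (hF ε (hV ε hε).1) (aφ ε hε), hLφ,
    ?_, ?_, fun i hi => D.N_le_ker_S hk hi, ?_, ?_, fun ε hε => hdiag.isGenInverse hε, aΔi,
    OperatorDiag.hasPole_of_eq (hga 0) (hg0 ▸ hTk)
      (eventually_nhdsWithin_of_forall fun ε hε => hg ε hε), ?_, ?_, ?_, ?_, ?_, ?_, ?_, ?_, ?_⟩
  · intro i hi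
    obtain ⟨i, rfl⟩ : ∃ l, i = l + 1 := ⟨i - 1, by have := Finset.mem_Icc.1 hi; omega⟩
    refine ⟨?_, D.map_Nc i, D.N_le_ker (by omega) le_rfl⟩
    rintro _ ⟨x, -, rfl⟩
    exact D.S_mem_Rc i x
  · intro l hl
    refine ⟨?_, D.N_le_ker_S hk (by omega)⟩
    rintro _ ⟨x, rfl⟩
    obtain ⟨l, rfl⟩ : ∃ m, l = m + 1 := ⟨l - 1, by omega⟩
    exact D.isSplitting_R.antitone (by omega) (D.S_mem_Rc (k + l) x)
  · intro ε hε
    rw [hψΔ ε hε, ← ContinuousLinearMap.comp_assoc, hψψ' ε hε, ContinuousLinearMap.id_comp]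
  · rintro ε ⟨hε, hε0⟩
    have hε0 : ε ≠ 0 := hε0
    constructor
    · ext x
      rw [LinearMap.mem_ker, ContinuousLinearMap.coe_coe, hFx ε hε]
      constructor
      · intro h0
        refine ⟨Ring.inverse (φ ε) x, (hkerDelta ε hε0 _).1 ?_, hφx ε hε x⟩
        rw [← hψ'x ε hε (OperatorDiag.Delta k S P ε (Ring.inverse (φ ε) x)), h0, map_zero]
      · rintro ⟨y, hy, rfl⟩
        rw [ContinuousLinearMap.coe_coe, hφ'x ε hε, (hkerDelta ε hε0 y).2 hy, map_zero]
    · rw [← hQrange, ← hdiag.range_Delta hε0]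
      ext y
      constructor
      · rintro ⟨x, rfl⟩
        exact ⟨_, ⟨Ring.inverse (φ ε) x, rfl⟩, (hFx ε hε x).symm⟩
      · rintro ⟨_, ⟨x, rfl⟩, rfl⟩
        refine ⟨φ ε x, ?_⟩
        rw [ContinuousLinearMap.coe_coe, hFx ε hε, hφ'x ε hε]
        rfl
  · rintro ε ⟨hε, hε0⟩
    obtain ⟨h1, h2⟩ := hdiag.isGenInverse (ε := ε) hε0
    constructor
    · ext x
      simp only [ContinuousLinearMap.comp_apply, hFx ε hε, hφ'x ε hε, hψ'x ε hε]
      exact congrArg (ψ ε) (DFunLike.congr_fun h1 _)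
    · ext x
      simp only [ContinuousLinearMap.comp_apply, hFx ε hε, hφ'x ε hε, hψ'x ε hε]
      exact congrArg (φ ε) (DFunLike.congr_fun h2 _)
  · rintro ε ⟨hε, hε0⟩
    exact OperatorDiag.analyticAt_clm_comp (aφ ε hε)
      (OperatorDiag.analyticAt_clm_comp (aΔi ε hε0) (aψi ε hε))
  -- `g` is `εᵏ Δ⁻¹(ε)` continued to `0`; since `φ` and `ψ⁻¹` are the identity at `0`, the leading
  -- coefficient is still `Tₖ₊₁ ≠ 0`.
  · refine OperatorDiag.hasPole_of_eq (g := fun ε => φ ε ∘L g ε ∘L Ring.inverse (ψ ε))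
      (OperatorDiag.analyticAt_clm_comp (aφ 0 hV0)
        (OperatorDiag.analyticAt_clm_comp (hga 0) (aψi 0 hV0))) ?_
      (eventually_nhdsWithin_of_forall fun ε hε => ?_)
    · rw [hφ1, hψi0, hg0, ContinuousLinearMap.comp_id, ContinuousLinearMap.id_comp]
      exact hTk
    · rw [hg ε hε, ContinuousLinearMap.smul_comp, ContinuousLinearMap.comp_smul]
  · rintro ε ⟨hε, hε0⟩
    constructor
    · ext x
      rw [← hdiag.DeltaInv_comp_Delta hε0]
      simp only [ContinuousLinearMap.comp_apply, hFx ε hε, hψ'x ε hε]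
    · ext x
      rw [← hdiag.Delta_comp_DeltaInv hε0]
      simp only [ContinuousLinearMap.comp_apply, hFx ε hε, hφ'x ε hε]
  · intro ε hε
    exact ⟨OperatorDiag.isIdempotentElem_conj (hφφ' ε hε) hPidem,
      (OperatorDiag.range_conj (hφφ' ε hε)).trans (by rw [hPrange]),
      OperatorDiag.isIdempotentElem_conj (hψψ' ε hε) hQidem,
      (OperatorDiag.range_conj (hψψ' ε hε)).trans (by rw [hQrange])⟩
  · exact fun ε hε => OperatorDiag.analyticAt_clm_comp (aφ ε hε)
      (OperatorDiag.analyticAt_clm_comp analyticAt_const (aφi ε hε))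
  · exact fun ε hε => OperatorDiag.analyticAt_clm_comp (aψ ε hε)
      (OperatorDiag.analyticAt_clm_comp analyticAt_const (aψi ε hε))
  · beta_reduce
    rw [hφi0, hφ1, ContinuousLinearMap.comp_id, ContinuousLinearMap.id_comp]
  · beta_reduce
    rw [hψi0, hψ1, ContinuousLinearMap.comp_id, ContinuousLinearMap.id_comp]
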